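/- Let $\Gamma$ be a finite-index subgroup of $\operatorname{SL}_2(\mathbb Z)$ and let $f$ be a modular function for $\Gamma$, i.e. a meromorphic function on the upper half plane, invariant under $\Gamma$ and meromorphic at all cusps. For $\gamma\in\operatorname{SL}_2(\mathbb Z)$ write $(f|_\gamma)(\tau)=f(\gamma\tau)$; the Fourier expansion of $f|_\gamma$ about $\infty$ is its Laurent expansion $\sum_{n\ge n_0}a_n e^{2\pi i n\tau/h}$, valid for $\operatorname{Im}\tau$ large, where $h$ is some positive integer. An expansion of $f$ at a cusp $c\in\mathbb P^1(\mathbb Q)$ is the Fourier expansion of $f|_\gamma$ about $\infty$ for a $\gamma\in\operatorname{SL}_2(\mathbb Z)$ with $\gamma\infty=c$. Suppose that the Fourier expansion of $f$ about $\infty$ has all its coefficients in a number field $K\subset\mathbb C$. Then: 1. for every $\gamma\in\operatorname{SL}_2(\mathbb Z)$ there is a number field $K'$ with $K\subseteq K'\subset\mathbb C$ such that the Fourier expansion of $f|_\gamma$ about $\infty$ has all its coefficients in $K'$; 2. for every cusp $c$ of $\Gamma$ there is a number field $K'$ with $K\subseteq K'\subset\mathbb C$ such that the expansions of $f$ at $c$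 (for all $\gamma\in\operatorname{SL}_2(\mathbb Z)$ with $\gamma\infty=c$) have all their coefficients in $K'$. -/

import Mathlib

open scoped MatrixGroups

/-- `a` is a Fourier expansion at `∞`, in the local parameter `q_h = exp (2πiτ/h)`, of the
meromorphic function `f` on the upper half plane: `a` is a formal Laurent series with finite
principal part and `f τ = ∑ aₙ q_hⁿ` for `Im τ` large. As meromorphic functions are only
well-defined up to their values on closed discrete sets (for instance at poles), the equality is
required off such a set. -/
def IsFourierExpansion (f : UpperHalfPlane → ℂ) (h : ℕ) (a : LaurentSeries ℂ) : Prop :=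
  0 < h ∧ ∃ B : ℝ, ∀ᶠ τ : UpperHalfPlane in Filter.codiscrete UpperHalfPlane, B < τ.im →
    HasSum (fun n : ℤ => a.coeff n * Function.Periodic.qParam (h : ℝ) (τ : ℂ) ^ n) (f τ)

/-- The weight zero slash action `f|γ`, `(f|γ)(τ) = f(γτ)`. -/
noncomputable def slashZero (f : UpperHalfPlane → ℂ) (γ : SL(2, ℤ)) : UpperHalfPlane → ℂ :=
  fun τ => f (γ • τ)

/-- `f` is a (meromorphic) modular function for the subgroup `Γ` of `SL₂(ℤ)`: it is meromorphic on
the upper half plane, invariant under `Γ` as a meromorphic function (that is, off a closed discrete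
set), and meromorphic at all cusps. -/
structure IsModularFunction (Γ : Subgroup SL(2, ℤ)) (f : UpperHalfPlane → ℂ) : Prop where
  meromorphic : MeromorphicOn (fun z : ℂ => f (UpperHalfPlane.ofComplex z))
    UpperHalfPlane.upperHalfPlaneSet
  invariant : ∀ γ ∈ Γ, slashZero f γ =ᶠ[Filter.codiscrete UpperHalfPlane] f
  meromorphic_at_cusps : ∀ γ : SL(2, ℤ), ∃ (h : ℕ) (a : LaurentSeries ℂ),
    IsFourierExpansion (slashZero f γ) h a

/-- The Fourier expansion of `f` at `∞` (exists and) has all its coefficients in `K ⊆ ℂ`. This does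
not depend on the choice of `h`: replacing `h` by a multiple only inserts zero coefficients. -/
def HasFourierCoeffsIn (f : UpperHalfPlane → ℂ) (K : IntermediateField ℚ ℂ) : Prop :=
  ∃ (h : ℕ) (a : LaurentSeries ℂ), IsFourierExpansion f h a ∧ ∀ n : ℤ, a.coeff n ∈ K

/-- The expansion of `f` at the cusp `c ∈ ℙ¹(ℚ)` has all its coefficients in `K ⊆ ℂ`. An expansion
of `f` at `c` is the Fourier expansion at `∞` of `f|γ`, where `γ ∈ SL₂(ℤ)` satisfies `γ∞ = c`; the
condition is imposed for all such `γ`. -/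
def HasCoeffsInAtCusp (f : UpperHalfPlane → ℂ) (c : OnePoint ℝ) (K : IntermediateField ℚ ℂ) :
    Prop :=
  ∀ γ : SL(2, ℤ), Matrix.SpecialLinearGroup.mapGL ℝ γ • (OnePoint.infty : OnePoint ℝ) = c →
    HasFourierCoeffsIn (slashZero f γ) K

/-! The function `f` is algebraic over `K(j)`, with a relation defined over `K`. As `j` is invariant
under `SL(2, ℤ)`, each `f|γ` satisfies the same relation, and a Laurent series algebraic over
`K(j)`, where `j` has rational coefficients, has its coefficients in a number field.

The relation comes from counting. The monomials `f^i j^k` with `i, k ≤ A` give `(A + 1)²` unknown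
coefficients. Killing the expansion at `∞` up to an order `M` is a system of `M` linear equations
over `K`. A combination vanishing to high order at `∞` must be zero: after clearing poles, its norm
to level one is divisible by so high a power of `Δ` that the quotient has negative weight
(`eq_zero_of_isBigO_discriminant_pow`). The order needed grows like a constant times `A`, so a large
`A` leaves a nontrivial solution in `K` (`IsModularFunction.exists_algebraic_relation`).

For the descent, Newton-style substitution shows that every coefficient of a root is algebraic. The
polynomial has only finitely many roots, so finitely many coefficients single out the given one;
Galois theory then puts all its coefficients in the field generated by these and `K`
(`exists_numberField_coeff_mem_of_eval₂_eq_zero`). -/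

/-! ### Power series algebraic over `K⟦X⟧`. -/

-- Once the largest power of `X` is divided out of `P`, reduction mod `X` leaves a nonzero
-- polynomial over `k` that kills the constant coefficient.
open Polynomial in
theorem PowerSeries.isAlgebraic_constantCoeff_of_eval₂_eq_zero {k L : Type*} [Field k] [Field L]
    [Algebra k L] {P : Polynomial (PowerSeries k)} (hP : P ≠ 0) {y : PowerSeries L}
    (hy : P.eval₂ (PowerSeries.map (algebraMap k L)) y = 0) :
    IsAlgebraic k (PowerSeries.constantCoeff y) := by
  have hX : ¬ IsUnit (Polynomial.C (PowerSeries.X : PowerSeries k)) := by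
    rw [Polynomial.isUnit_C]
    exact PowerSeries.X_prime.not_isUnit
  obtain ⟨P₀, hm, hP₀⟩ :=
    (FiniteMultiplicity.of_not_isUnit hX hP).exists_eq_pow_mul_and_not_dvd
  have hy₀ : P₀.eval₂ (PowerSeries.map (algebraMap k L)) y = 0 := by
    rw [hm, eval₂_mul, eval₂_pow, Polynomial.eval₂_C, PowerSeries.map_X] at hy
    exact (mul_eq_zero.mp hy).resolve_left (pow_ne_zero _ PowerSeries.X_ne_zero)
  refine ⟨P₀.map PowerSeries.constantCoeff, fun h => hP₀ ?_, ?_⟩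
  · rw [Polynomial.C_dvd_iff_dvd_coeff]
    intro i
    rw [PowerSeries.X_dvd_iff]
    simpa using congrArg (fun p => p.coeff i) h
  · have := congrArg PowerSeries.constantCoeff hy₀
    rw [Polynomial.hom_eval₂, map_zero] at this
    have hc : PowerSeries.constantCoeff.comp (PowerSeries.map (algebraMap k L)) =
        (algebraMap k L).comp PowerSeries.constantCoeff := by
      ext z
      rw [RingHom.comp_apply, RingHom.comp_apply, ← PowerSeries.coeff_zero_eq_constantCoeff_apply,
        ← PowerSeries.coeff_zero_eq_constantCoeff_apply, PowerSeries.coeff_map]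
    rwa [Polynomial.aeval_def, Polynomial.eval₂_map, ← hc]

-- Peel off one coefficient at a time: with `y = a + X z`, the tail `z` is a root of `P(a + X Z)`,
-- which is nonzero because `a + X Z` is not constant in `Z`.
open Polynomial in
theorem PowerSeries.coeff_mem_range_of_eval₂_eq_zero {k L : Type*} [Field k] [Field L]
    [Algebra k L] (hk : ∀ x : L, IsAlgebraic k x → x ∈ (algebraMap k L).range) (n : ℕ)
    {P : Polynomial (PowerSeries k)} (hP : P ≠ 0) {y : PowerSeries L}
    (hy : P.eval₂ (PowerSeries.map (algebraMap k L)) y = 0) :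
    y.coeff n ∈ (algebraMap k L).range := by
  induction n generalizing P y with
  | zero =>
    rw [PowerSeries.coeff_zero_eq_constantCoeff]
    exact hk _ (isAlgebraic_constantCoeff_of_eval₂_eq_zero hP hy)
  | succ n ih =>
    obtain ⟨a, ha⟩ := hk _ (isAlgebraic_constantCoeff_of_eval₂_eq_zero hP hy)
    obtain ⟨z, hz⟩ : PowerSeries.X ∣ y - PowerSeries.C (algebraMap k L a) := by
      rw [PowerSeries.X_dvd_iff]
      simp [ha]
    have hyz : y = PowerSeries.C (algebraMap k L a) + PowerSeries.X * z := by
      rw [← hz]; ring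
    have hcoeff : y.coeff (n + 1) = z.coeff n := by
      rw [hyz, map_add, PowerSeries.coeff_succ_X_mul, PowerSeries.coeff_C]
      simp
    rw [hcoeff]
    refine ih (P := P.comp (Polynomial.C (PowerSeries.C a) + Polynomial.C PowerSeries.X * Polynomial.X)) ?_ ?_
    · intro h
      rcases Polynomial.comp_eq_zero_iff.mp h with h | ⟨-, h⟩
      · exact hP h
      · have := congrArg (fun p => p.coeff 1) h
        simp [Polynomial.coeff_C] at this
    · rw [Polynomial.eval₂_comp]
      have : (Polynomial.C (PowerSeries.C a) + Polynomial.C PowerSeries.X * Polynomial.X).eval₂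
          (PowerSeries.map (algebraMap k L)) z = y := by
        simp only [Polynomial.eval₂_add, Polynomial.eval₂_mul, Polynomial.eval₂_C,
          Polynomial.eval₂_X, PowerSeries.map_C, PowerSeries.map_X, hyz]
      rw [this, hy]

/-- Algebraicity of each coefficient does not bound the degree of the field they generate. The bound
comes from the finiteness of the set of roots, which Galois conjugation over `K` permutes. -/
theorem exists_numberField_coeff_mem_of_eval₂_eq_zero (K : IntermediateField ℚ ℂ)
    (hK : NumberField K) {P : Polynomial (PowerSeries K)} (hP : P ≠ 0) {y : PowerSeries ℂ}
    (hy : P.eval₂ (PowerSeries.map (algebraMap K ℂ)) y = 0) :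
    ∃ K' : IntermediateField ℚ ℂ, NumberField K' ∧ K ≤ K' ∧ ∀ n, y.coeff n ∈ K' := by
  classical
  set k := algebraicClosure ℚ ℂ with hkdef
  have hKk : K ≤ k := le_algebraicClosure ℚ ℂ K
  have hkalg : Algebra.IsAlgebraic ℚ k := algebraicClosure.isAlgebraic ℚ ℂ
  have hkint : Algebra.IsIntegral ℚ k := hkalg.isIntegral
  have hclosure : IsAlgClosure ℚ k := algebraicClosure.isAlgClosure ℚ ℂ
  have hnormal : Normal ℚ k := IsAlgClosure.normal ℚ k
  have hgal : IsGalois ℚ k := ⟨⟩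
  let ι : K →+* k := (IntermediateField.inclusion hKk).toRingHom
  have hk : ∀ x : ℂ, IsAlgebraic k x → x ∈ (algebraMap k ℂ).range := by
    intro x hx
    have : IsAlgebraic ℚ x := by
      exact hx.restrictScalars ℚ
    exact ⟨⟨x, (mem_algebraicClosure_iff).mpr this⟩, rfl⟩
  set Q := P.map (PowerSeries.map ι) with hQdef
  have hQ : Q ≠ 0 := by
    rw [hQdef, Polynomial.map_ne_zero_iff]
    · exact hP
    · exact PowerSeries.map_injective _ ι.injective
  have hQy : Q.eval₂ (PowerSeries.map (algebraMap k ℂ)) y = 0 := by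
    rw [hQdef, Polynomial.eval₂_map]
    convert hy using 2
    ext z
    simp [ι]
  have hcoeff := fun n => PowerSeries.coeff_mem_range_of_eval₂_eq_zero hk n hQ hQy
  choose a ha using hcoeff
  set y' : PowerSeries k := PowerSeries.mk a with hy'
  have hyy' : y = PowerSeries.map (algebraMap k ℂ) y' := by
    ext n; simp [hy', ha]
  have hroot : Q.IsRoot y' := by
    have h := hQy
    rw [hyy', Polynomial.eval₂_at_apply] at h
    exact (map_eq_zero_iff _ (PowerSeries.map_injective _ (algebraMap k ℂ).injective)).mp h
  have hsep : ∀ z : PowerSeries k, ∃ n, z ≠ y' → z.coeff n ≠ y'.coeff n := by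
    intro z
    by_contra! h
    exact (h 0).1 (PowerSeries.ext fun n => (h n).2)
  choose d hd using hsep
  -- One separating coefficient of `y'` for each root; an automorphism fixing these and `K` cannot
  -- move `y'` to another root.
  let T : Finset k := Q.roots.toFinset.image fun z => a (d z)
  let K₀ : IntermediateField ℚ k :=
    IntermediateField.restrict hKk ⊔ IntermediateField.adjoin ℚ (T : Set k)
  have hK₁ : FiniteDimensional ℚ (IntermediateField.restrict hKk) :=
    LinearEquiv.finiteDimensional (IntermediateField.restrictAlgEquiv hKk).toLinearEquiv
  have hT : FiniteDimensional ℚ (IntermediateField.adjoin ℚ (T : Set k)) :=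
    IntermediateField.finiteDimensional_adjoin fun x _ => Algebra.IsIntegral.isIntegral x
  have hK₀ : FiniteDimensional ℚ K₀ := IntermediateField.finiteDimensional_sup _ _
  have hfix : ∀ n, a n ∈ K₀ := by
    intro n
    rw [← InfiniteGalois.fixedField_fixingSubgroup K₀]
    rintro ⟨σ, hσ⟩
    have hσ' : ∀ x ∈ K₀, σ x = x := fun x hx => hσ ⟨x, hx⟩
    change σ (a n) = a n
    let s : k →+* k := σ.toRingEquiv.toRingHom
    have hs : s.comp ι = ι := by
      ext x
      have h : ι x ∈ K₀ :=
        (le_sup_left : _ ≤ K₀) ((IntermediateField.mem_restrict hKk _).mpr x.2)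
      exact congrArg _ (hσ' _ h)
    have hQs : Q.map (PowerSeries.map s) = Q := by
      rw [hQdef, Polynomial.map_map]
      congr 1
      ext z m
      simp only [RingHom.comp_apply, PowerSeries.coeff_map]
      exact congrArg _ (RingHom.congr_fun hs _)
    have hr : Q.IsRoot (PowerSeries.map s y') := by
      have := hroot.map (f := PowerSeries.map s)
      rwa [hQs] at this
    have : PowerSeries.map s y' = y' := by
      by_contra hne
      apply hd _ hne
      rw [PowerSeries.coeff_map, hy', PowerSeries.coeff_mk]
      apply hσ'
      apply (le_sup_right : _ ≤ K₀)
      apply IntermediateField.subset_adjoin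
      rw [Finset.mem_coe, Finset.mem_image]
      exact ⟨_, by simpa [hQ] using hr, rfl⟩
    have := congrArg (PowerSeries.coeff n) this
    rwa [PowerSeries.coeff_map, hy', PowerSeries.coeff_mk] at this
  refine ⟨IntermediateField.lift K₀, ?_, ?_, ?_⟩
  · have : FiniteDimensional ℚ (IntermediateField.lift K₀) :=
      LinearEquiv.finiteDimensional (IntermediateField.liftAlgEquiv K₀).toLinearEquiv
    exact { to_charZero := inferInstance, to_finiteDimensional := this }
  · intro x hx
    have : (⟨x, hKk hx⟩ : k) ∈ K₀ :=
      (le_sup_left : _ ≤ K₀) ((IntermediateField.mem_restrict hKk _).mpr hx)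
    exact (IntermediateField.mem_lift (⟨x, hKk hx⟩ : k)).mpr this
  · intro n
    rw [← ha n]
    exact (IntermediateField.mem_lift (a n)).mpr (hfix n)

/-! ### Identities off closed discrete sets, and removable singularities. -/

namespace UpperHalfPlane

open Filter Topology Function
open scoped Manifold

theorem eventually_codiscrete_iff {p : ℍ → Prop} :
    (∀ᶠ τ in codiscrete ℍ, p τ) ↔ ∀ τ, ∀ᶠ z in 𝓝[≠] τ, p z := by
  simp [Filter.Eventually, codiscrete, mem_codiscreteWithin_iff_forall_mem_nhdsNE]

theorem eq_of_eventuallyEq_codiscrete {f g : ℍ → ℂ} (hf : MDiff f) (hg : MDiff g)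
    (h : f =ᶠ[codiscrete ℍ] g) : f = g := by
  rw [← sub_eq_zero]
  refine eq_zero_of_frequently (τ := I) (hf.sub hg) (Eventually.frequently ?_)
  filter_upwards [eventually_codiscrete_iff.mp h I] with z hz
  simp [hz]

theorem eventually_ne_zero_codiscrete {f : ℍ → ℂ} (hf : MDiff f) (h : f ≠ 0) :
    ∀ᶠ τ in codiscrete ℍ, f τ ≠ 0 := by
  rw [eventually_codiscrete_iff]
  intro τ
  by_contra hτ
  exact h (eq_zero_of_frequently hf (not_eventually.mp hτ |>.mono fun _ => not_not.mp))

theorem tendsto_smul_nhdsNE (γ : SL(2, ℤ)) (τ : ℍ) :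
    Tendsto (fun τ : ℍ => γ • τ) (𝓝[≠] τ) (𝓝[≠] (γ • τ)) :=
  tendsto_nhdsWithin_of_tendsto_nhds_of_eventually_within _
    ((continuous_const_smul (Matrix.SpecialLinearGroup.mapGL ℝ γ)).continuousAt.tendsto.mono_left
      nhdsWithin_le_nhds)
    (eventually_mem_nhdsWithin.mono fun _ hz h => hz (MulAction.injective γ h))

theorem tendsto_smul_codiscrete (γ : SL(2, ℤ)) :
    Tendsto (fun τ : ℍ => γ • τ) (codiscrete ℍ) (codiscrete ℍ) := by
  intro s hs
  exact eventually_codiscrete_iff.mpr fun τ => tendsto_smul_nhdsNE γ τ (eventually_codiscrete_iff.mp hs (γ • τ))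

/-- `g` agrees with a holomorphic function on a punctured neighbourhood of `τ`. -/
def HasHoloExtensionAt (g : ℍ → ℂ) (τ : ℍ) : Prop :=
  ∃ E : ℂ → ℂ, AnalyticAt ℂ E τ ∧ ∀ᶠ z : ℍ in 𝓝[≠] τ, g z = E z

namespace HasHoloExtensionAt

variable {f g : ℍ → ℂ} {τ : ℍ}

theorem congr (hf : HasHoloExtensionAt f τ) (h : f =ᶠ[codiscrete ℍ] g) :
    HasHoloExtensionAt g τ := by
  obtain ⟨E, hE, hfE⟩ := hf
  refine ⟨E, hE, ?_⟩
  filter_upwards [hfE, eventually_codiscrete_iff.mp h τ] with z h₁ h₂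
  rw [← h₂, h₁]

theorem mul (hf : HasHoloExtensionAt f τ) (hg : HasHoloExtensionAt g τ) :
    HasHoloExtensionAt (f * g) τ := by
  obtain ⟨E, hE, hfE⟩ := hf
  obtain ⟨E', hE', hgE'⟩ := hg
  refine ⟨E * E', hE.mul hE', ?_⟩
  filter_upwards [hfE, hgE'] with z h₁ h₂
  simp [h₁, h₂]

theorem of_mdifferentiable (hf : MDiff f) (τ : ℍ) : HasHoloExtensionAt f τ :=
  ⟨f ∘ ofComplex, (mdifferentiable_iff.mp hf).analyticAt
    (isOpen_upperHalfPlaneSet.mem_nhds τ.im_pos), .of_forall fun z => by simp⟩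

theorem comp_smul {γ : SL(2, ℤ)} (hf : HasHoloExtensionAt f (γ • τ)) :
    HasHoloExtensionAt (fun z => f (γ • z)) τ := by
  obtain ⟨E, hE, hfE⟩ := hf
  let g : GL (Fin 2) ℝ := Matrix.SpecialLinearGroup.mapGL ℝ γ
  have hg : 0 < g.val.det := by
    rw [Matrix.SpecialLinearGroup.mapGL_coe_matrix, Matrix.SpecialLinearGroup.det_coe]
    exact one_pos
  refine ⟨E ∘ fun z : ℂ => ((g • ofComplex z : ℍ) : ℂ), ?_, ?_⟩
  · refine AnalyticAt.comp ?_ (analyticAt_smul hg τ)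
    rw [ofComplex_apply]
    exact hE
  · filter_upwards [tendsto_smul_nhdsNE γ τ hfE] with z hz
    rw [comp_apply, ofComplex_apply]
    exact hz

theorem eventually_nhds (hf : HasHoloExtensionAt f τ) :
    ∀ᶠ z in 𝓝 τ, HasHoloExtensionAt f z := by
  obtain ⟨E, hE, hfE⟩ := hf
  filter_upwards [continuous_coe.continuousAt.eventually hE.eventually_analyticAt,
    eventually_eventually_nhds.mpr (eventually_nhdsWithin_iff.mp hfE)] with z h₁ h₂
  refine ⟨E, h₁, ?_⟩
  have h₃ : ∀ᶠ w in 𝓝[≠] z, w ≠ τ := by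
    rcases eq_or_ne z τ with rfl | h
    · exact eventually_mem_nhdsWithin
    · exact (eventually_ne_nhds h).filter_mono nhdsWithin_le_nhds
  filter_upwards [h₃, h₂.filter_mono nhdsWithin_le_nhds] with w h₄ h₅ using h₅ h₄

/-- The local extensions glue: for `z` near `τ`, those chosen at `z` and at `τ` are continuous at
`z` and agree with `f` on a punctured neighbourhood of `z`, hence agree at `z`. -/
theorem exists_mdifferentiable (hf : ∀ τ, HasHoloExtensionAt f τ) :
    ∃ F : ℍ → ℂ, MDiff F ∧ f =ᶠ[codiscrete ℍ] F := by
  choose E hE hfE using hf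
  have key : ∀ τ, ∀ᶠ z : ℍ in 𝓝 τ, E z z = E τ z := by
    intro τ
    filter_upwards [continuous_coe.continuousAt.eventually (hE τ).eventually_analyticAt,
      eventually_eventually_nhds.mpr (eventually_nhdsWithin_iff.mp (hfE τ))] with z h₁ h₂
    rcases eq_or_ne z τ with rfl | h
    · rfl
    have hlim : ∀ {E : ℂ → ℂ}, AnalyticAt ℂ E z →
        Tendsto (fun w : ℍ => E w) (𝓝[≠] z) (𝓝 (E z)) := fun hE =>
      (hE.continuousAt.tendsto.comp continuous_coe.continuousAt.tendsto).mono_left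
        nhdsWithin_le_nhds
    refine tendsto_nhds_unique_of_eventuallyEq (hlim (hE z)) (hlim h₁) ?_
    filter_upwards [hfE z, h₂.filter_mono nhdsWithin_le_nhds,
      (eventually_ne_nhds h).filter_mono nhdsWithin_le_nhds] with w h₃ h₄ h₅
    rw [← h₃, h₄ h₅]
  refine ⟨fun τ => E τ τ, fun τ => ?_, eventually_codiscrete_iff.mpr fun τ => ?_⟩
  · rw [mdifferentiableAt_iff]
    refine (hE τ).differentiableAt.congr_of_eventuallyEq ?_
    rw [EventuallyEq, ← isOpenEmbedding_coe.map_nhds_eq, eventually_map]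
    filter_upwards [key τ] with z hz
    simpa using hz
  · filter_upwards [hfE τ, (key τ).filter_mono nhdsWithin_le_nhds] with z h₁ h₂
    rw [h₁, h₂]

end HasHoloExtensionAt

end UpperHalfPlane

/-! ### Power series in the local parameter at `∞`. -/

namespace UpperHalfPlane

open Filter Topology Function
open scoped Manifold

local notation "𝕢" => Periodic.qParam

/-- Off a closed discrete set, `φ` is given for large `Im τ` by the power series `p` in the local
parameter `q_h = exp (2πiτ/h)`. -/
def HasQSeries (φ : ℍ → ℂ) (h : ℕ) (p : PowerSeries ℂ) : Prop :=
  ∃ B : ℝ, ∀ᶠ τ : ℍ in codiscrete ℍ, B < τ.im →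
    HasSum (fun m : ℕ => p.coeff m * 𝕢 (h : ℝ) (τ : ℂ) ^ m) (φ τ)

theorem frequently_atImInfty_of_eventually_codiscrete {P : ℍ → Prop}
    (h : ∀ᶠ τ in codiscrete ℍ, P τ) : ∃ᶠ τ in atImInfty, P τ := by
  rw [Filter.Frequently, Filter.Eventually, atImInfty_mem]
  rintro ⟨A, hA⟩
  let τ₀ : ℍ := ⟨⟨0, max A 0 + 1⟩, by simp only; positivity⟩
  have h₁ : ∀ᶠ z : ℍ in 𝓝[≠] τ₀, A < z.im := by
    refine Filter.Eventually.filter_mono nhdsWithin_le_nhds ?_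
    refine continuous_im.continuousAt.eventually (lt_mem_nhds ?_)
    exact lt_of_le_of_lt (le_max_left A 0) (lt_add_one _)
  obtain ⟨z, h₂, h₃⟩ := (h₁.and (eventually_codiscrete_iff.mp h τ₀)).exists
  exact hA z h₂.le h₃

namespace HasQSeries

variable {φ χ : ℍ → ℂ} {h : ℕ} {p r : PowerSeries ℂ}

theorem congr (hφ : HasQSeries φ h p) (e : φ =ᶠ[codiscrete ℍ] χ) : HasQSeries χ h p := by
  obtain ⟨B, hB⟩ := hφ
  refine ⟨B, ?_⟩
  filter_upwards [hB, e] with τ h₁ h₂ h₃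
  rw [← h₂]
  exact h₁ h₃

theorem add (hφ : HasQSeries φ h p) (hχ : HasQSeries χ h r) : HasQSeries (φ + χ) h (p + r) := by
  obtain ⟨B, hB⟩ := hφ
  obtain ⟨B', hB'⟩ := hχ
  refine ⟨max B B', ?_⟩
  filter_upwards [hB, hB'] with τ h₁ h₂ h₃
  simpa only [map_add, add_mul, Pi.add_apply] using
    (h₁ ((le_max_left _ _).trans_lt h₃)).add (h₂ ((le_max_right _ _).trans_lt h₃))

theorem mul (hφ : HasQSeries φ h p) (hχ : HasQSeries χ h r) : HasQSeries (φ * χ) h (p * r) := by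
  obtain ⟨B, hB⟩ := hφ
  obtain ⟨B', hB'⟩ := hχ
  refine ⟨max B B', ?_⟩
  filter_upwards [hB, hB'] with τ h₁ h₂ h₃
  replace h₁ := h₁ ((le_max_left _ _).trans_lt h₃)
  replace h₂ := h₂ ((le_max_right _ _).trans_lt h₃)
  have hs := summable_norm_sum_mul_antidiagonal_of_summable_norm h₁.summable.norm h₂.summable.norm
  have ht := tsum_mul_tsum_eq_tsum_sum_antidiagonal_of_summable_norm
    h₁.summable.norm h₂.summable.norm
  rw [h₁.tsum_eq, h₂.tsum_eq] at ht
  rw [Pi.mul_apply, ht]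
  refine hs.of_norm.hasSum.congr_fun fun m => ?_
  rw [PowerSeries.coeff_mul, Finset.sum_mul]
  refine Finset.sum_congr rfl fun x hx => ?_
  rw [← Finset.HasAntidiagonal.mem_antidiagonal.mp hx, pow_add]
  ring

theorem const (c : ℂ) (h : ℕ) : HasQSeries (fun _ => c) h (PowerSeries.C c) := by
  refine ⟨0, .of_forall fun τ _ => ?_⟩
  convert hasSum_ite_eq 0 c using 2 with m
  rw [PowerSeries.coeff_C]
  split_ifs with hm <;> simp [hm]

theorem qParam_pow (h n : ℕ) : HasQSeries (fun τ => 𝕢 h τ ^ n) h (PowerSeries.X ^ n) := by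
  refine ⟨0, .of_forall fun τ _ => ?_⟩
  convert hasSum_ite_eq n (𝕢 h τ ^ n) using 2 with m
  rw [PowerSeries.coeff_X_pow]
  split_ifs with hm <;> simp [hm]

theorem pow (hφ : HasQSeries φ h p) (n : ℕ) : HasQSeries (φ ^ n) h (p ^ n) := by
  induction n with
  | zero => simpa using! const 1 h
  | succ n ih => simpa only [pow_succ] using ih.mul hφ

theorem sum {ι : Type*} {s : Finset ι} {φ : ι → ℍ → ℂ} {p : ι → PowerSeries ℂ}
    (hφ : ∀ i ∈ s, HasQSeries (φ i) h (p i)) :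
    HasQSeries (∑ i ∈ s, φ i) h (∑ i ∈ s, p i) := by
  classical
  induction s using Finset.induction_on with
  | empty => simpa using! const 0 h
  | insert i s hi ih =>
    rw [Finset.sum_insert hi, Finset.sum_insert hi]
    exact (hφ i (Finset.mem_insert_self i s)).add
      (ih fun j hj => hφ j (Finset.mem_insert_of_mem hj))

/-- Convergence at a single point `τ₀` gives a positive radius, so the sum is analytic in `q`
wherever `Im τ > Im τ₀`. -/
theorem exists_analytic (hh : 0 < h) (hφ : HasQSeries φ h p) :
    ∃ (ψ : ℂ → ℂ) (B : ℝ), HasFPowerSeriesAt ψ (.ofScalars ℂ fun m => p.coeff m) 0 ∧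
      (∀ τ : ℍ, B < τ.im → AnalyticAt ℂ ψ (𝕢 h τ)) ∧
      ∀ᶠ τ : ℍ in codiscrete ℍ, B < τ.im → φ τ = ψ (𝕢 h τ) := by
  obtain ⟨B, hB⟩ := hφ
  obtain ⟨τ₀, h₀, hτ₀⟩ := ((frequently_atImInfty_of_eventually_codiscrete hB).and_eventually
    ((atImInfty_mem _).mpr ⟨B + 1, fun z hz => hz⟩)).exists
  have hs := (h₀ (lt_of_lt_of_le (lt_add_one B) hτ₀)).summable
  set P : FormalMultilinearSeries ℂ ℂ ℂ := .ofScalars ℂ fun m => p.coeff m with hP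
  have hrad : (‖𝕢 h τ₀‖₊ : ENNReal) ≤ P.radius := by
    apply FormalMultilinearSeries.le_radius_of_summable
    refine hs.norm.congr fun m => ?_
    rw [norm_mul, norm_pow, hP, FormalMultilinearSeries.ofScalars_norm, coe_nnnorm]
  have hpos : 0 < P.radius := lt_of_lt_of_le (by simp [Periodic.qParam_ne_zero]) hrad
  have hball := P.hasFPowerSeriesOnBall hpos
  have hmem : ∀ τ : ℍ, max B τ₀.im < τ.im → 𝕢 h τ ∈ Metric.eball (0 : ℂ) P.radius := by
    intro τ hτ
    rw [Metric.mem_eball, edist_zero_right]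
    refine lt_of_lt_of_le ?_ hrad
    rw [enorm_eq_nnnorm, ENNReal.coe_lt_coe, ← NNReal.coe_lt_coe, coe_nnnorm, coe_nnnorm,
      Periodic.norm_qParam (z := (τ₀ : ℂ)), Periodic.norm_qParam_lt_iff (Nat.cast_pos.mpr hh)]
    exact (le_max_right _ _).trans_lt hτ
  refine ⟨P.sum, max B τ₀.im, hball.hasFPowerSeriesAt, fun τ hτ => ?_, ?_⟩
  · exact hball.analyticAt_of_mem (hmem τ hτ)
  · filter_upwards [hB] with τ h₁ h₂
    refine (h₁ ((le_max_left _ _).trans_lt h₂)).unique ?_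
    have := hball.hasSum (hmem τ h₂)
    rw [zero_add] at this
    refine this.congr_fun fun m => ?_
    rw [hP, FormalMultilinearSeries.ofScalars_apply_eq, smul_eq_mul]

/-- Uniqueness of expansions: the analytic sum has zeros accumulating at `q = 0`. -/
theorem eq_zero (hh : 0 < h) (hφ : HasQSeries φ h p) (h0 : φ =ᶠ[codiscrete ℍ] 0) : p = 0 := by
  obtain ⟨ψ, B, hψ, -, hB⟩ := hφ.exists_analytic hh
  have hf : ∃ᶠ τ : ℍ in atImInfty, ψ (𝕢 h τ) = 0 := by
    refine ((frequently_atImInfty_of_eventually_codiscrete (hB.and h0)).and_eventually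
      ((atImInfty_mem _).mpr ⟨B + 1, fun z hz => hz⟩)).mono ?_
    rintro τ ⟨⟨h₁, h₂⟩, h₃⟩
    rw [← h₁ (lt_of_lt_of_le (lt_add_one B) h₃), h₂]
    rfl
  have ht : Tendsto (fun τ : ℍ => 𝕢 h τ) atImInfty (𝓝[≠] 0) :=
    tendsto_nhdsWithin_of_tendsto_nhds_of_eventually_within _
      (qParam_tendsto_atImInfty (Nat.cast_pos.mpr hh))
      (.of_forall fun τ => Periodic.qParam_ne_zero _)
  have hz := (hψ.analyticAt.frequently_zero_iff_eventually_zero).mp (ht.frequently hf)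
  have := hψ.eq_zero_of_eventually hz
  ext m
  have := congrArg (fun P => P.coeff m) this
  rwa [FormalMultilinearSeries.coeff_ofScalars] at this

theorem hasHoloExtensionAt (hh : 0 < h) (hφ : HasQSeries φ h p) :
    ∃ B : ℝ, ∀ τ : ℍ, B < τ.im → HasHoloExtensionAt φ τ := by
  obtain ⟨ψ, B, -, hψ, hB⟩ := hφ.exists_analytic hh
  refine ⟨B, fun τ hτ => ⟨fun z => ψ (𝕢 h z), ?_, ?_⟩⟩
  · refine (hψ τ hτ).comp ?_
    exact (Periodic.differentiable_qParam (h := h)).analyticAt _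
  · filter_upwards [eventually_codiscrete_iff.mp hB τ,
      (continuous_im.continuousAt.eventually (lt_mem_nhds hτ)).filter_mono nhdsWithin_le_nhds]
      with z h₁ h₂ using h₁ h₂

/-- Taylor's estimate at `q = 0`; it turns linear conditions on coefficients into decay at `∞`. -/
theorem norm_le (hh : 0 < h) (hφ : HasQSeries φ h p) {M : ℕ} (hM : ∀ m < M, p.coeff m = 0) :
    ∃ B C : ℝ, ∀ᶠ τ : ℍ in codiscrete ℍ, B < τ.im → ‖φ τ‖ ≤ C * ‖𝕢 h τ‖ ^ M := by
  obtain ⟨ψ, B, hψ, -, hB⟩ := hφ.exists_analytic hh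
  have h₁ := hψ.isBigO_sub_partialSum_pow M
  obtain ⟨C, hC⟩ := h₁.bound
  obtain ⟨B', hB'⟩ := (atImInfty_mem _).mp
    ((qParam_tendsto_atImInfty (Nat.cast_pos.mpr hh)).eventually hC)
  refine ⟨max B B', C, ?_⟩
  filter_upwards [hB] with τ h₂ h₃
  rw [h₂ ((le_max_left _ _).trans_lt h₃)]
  have := hB' τ ((le_max_right _ _).trans_lt h₃).le
  have hz : (FormalMultilinearSeries.ofScalars ℂ fun m => p.coeff m).partialSum M (𝕢 h τ) = 0 := by
    refine Finset.sum_eq_zero fun m hm => ?_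
    simp [hM m (Finset.mem_range.mp hm)]
  simpa [hz] using this

end HasQSeries

end UpperHalfPlane

theorem IsFourierExpansion.exists_hasQSeries {f : UpperHalfPlane → ℂ} {h : ℕ} {a : LaurentSeries ℂ}
    (hf : IsFourierExpansion f h a) :
    ∃ (N : ℕ) (p : PowerSeries ℂ), (∀ m : ℕ, p.coeff m = a.coeff ((m : ℤ) - N)) ∧
      (∀ n : ℤ, n < -N → a.coeff n = 0) ∧
      UpperHalfPlane.HasQSeries
        (fun τ => Function.Periodic.qParam (h : ℝ) (τ : ℂ) ^ N * f τ) h p := by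
  obtain ⟨hh, B, hB⟩ := hf
  -- A bound for the pole order at `q = 0`; it is `0` when there is no pole.
  set N : ℕ := (-a.order).toNat with hN
  have hzero : ∀ n : ℤ, n < -N → a.coeff n = 0 := fun n hn =>
    HahnSeries.coeff_eq_zero_of_lt_order (by omega)
  refine ⟨N, PowerSeries.mk fun m => a.coeff ((m : ℤ) - N), fun m => PowerSeries.coeff_mk _ _,
    hzero, B, ?_⟩
  filter_upwards [hB] with τ h₁ h₂
  set q := Function.Periodic.qParam (h : ℝ) (τ : ℂ) with hq
  have hq0 : q ≠ 0 := Function.Periodic.qParam_ne_zero _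
  have hinj : Function.Injective fun m : ℕ => (m : ℤ) - N := fun x y hxy => by
    simpa using hxy
  have h₃ := (h₁ h₂).mul_left (q ^ N)
  rw [← hinj.hasSum_iff] at h₃
  · refine h₃.congr_fun fun m => ?_
    rw [PowerSeries.coeff_mk, Function.comp_apply, zpow_sub₀ hq0, zpow_natCast, zpow_natCast]
    field_simp
  · intro n hn
    rw [hzero n, zero_mul, mul_zero]
    by_contra hlt
    exact hn ⟨(n + N).toNat, by simp only; omega⟩

/-! ### Rational expansions of `E₄` and `Δ`, and the `j`-invariant. -/

namespace UpperHalfPlane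

open Filter Topology Function ModularForm
open scoped Manifold

local notation "𝕢" => Periodic.qParam
local notation "Δ" => ModularForm.discriminant

/-- Substitutes `q₁ = q_h ^ h`, so that level-one expansions can be compared with expansions of any
width `h`. -/
theorem hasQSeries_of_hasSum {φ : ℍ → ℂ} {c : ℕ → ℂ}
    (hφ : ∀ τ : ℍ, HasSum (fun m => c m * 𝕢 1 τ ^ m) (φ τ)) {h : ℕ} (hh : 0 < h) :
    HasQSeries φ h (PowerSeries.mk fun m => if h ∣ m then c (m / h) else 0) := by
  refine ⟨0, .of_forall fun τ _ => ?_⟩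
  have hinj : Function.Injective fun m : ℕ => h * m := fun x y hxy =>
    Nat.eq_of_mul_eq_mul_left hh hxy
  rw [← hinj.hasSum_iff]
  · refine (hφ τ).congr_fun fun m => ?_
    rw [comp_apply, PowerSeries.coeff_mk, if_pos (dvd_mul_right h m), Nat.mul_div_cancel_left m hh,
      pow_mul]
    congr 2
    rw [Periodic.qParam, Periodic.qParam, ← Complex.exp_nat_mul]
    congr 1
    have : (h : ℂ) ≠ 0 := by exact_mod_cast hh.ne'
    push_cast
    field_simp
  · intro m hm
    rw [PowerSeries.coeff_mk, if_neg, zero_mul]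
    rintro ⟨n, rfl⟩
    exact hm ⟨n, rfl⟩

theorem exists_hasQSeries_E {k : ℕ} (hk : 3 ≤ k) (hk2 : Even k) {h : ℕ} (hh : 0 < h) :
    ∃ u : PowerSeries ℚ, PowerSeries.constantCoeff u = 1 ∧
      HasQSeries (ModularForm.E hk) h (PowerSeries.map (algebraMap ℚ ℂ) u) := by
  let c : ℕ → ℚ := fun m =>
    if m = 0 then 1 else -(2 * k / bernoulli k) * (ArithmeticFunction.sigma (k - 1) m)
  refine ⟨PowerSeries.mk fun m => if h ∣ m then c (m / h) else 0, by simp [c], ?_⟩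
  have hs : ∀ τ : ℍ, HasSum (fun m => (c m : ℂ) * 𝕢 1 τ ^ m) (ModularForm.E hk τ) := by
    intro τ
    have := ModularForm.hasSum_qExpansion (ModularForm.E hk) one_pos
      one_mem_strictPeriods_SL τ
    refine this.congr_fun fun m => ?_
    rw [EisensteinSeries.E_qExpansion_coeff hk hk2]
    simp only [c]
    split_ifs <;> push_cast <;> rfl
  convert hasQSeries_of_hasSum hs hh using 1
  ext m
  simp only [PowerSeries.coeff_map, PowerSeries.coeff_mk]
  split_ifs <;> simp

/-- Rationality comes from `1728 Δ = E₄³ - E₆²`, whose constant terms cancel; the series is nonzero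
since `Δ` has no zeros on `ℍ`. -/
theorem exists_hasQSeries_discriminant {h : ℕ} (hh : 0 < h) :
    ∃ u : PowerSeries ℚ, PowerSeries.constantCoeff u = 0 ∧ u ≠ 0 ∧
      HasQSeries Δ h (PowerSeries.map (algebraMap ℚ ℂ) u) := by
  obtain ⟨u₄, h₄, hu₄⟩ := exists_hasQSeries_E (k := 4) (by norm_num) ⟨2, rfl⟩ hh
  obtain ⟨u₆, h₆, hu₆⟩ := exists_hasQSeries_E (k := 6) (by norm_num) ⟨3, rfl⟩ hh
  have hΔ : HasQSeries Δ h (PowerSeries.map (algebraMap ℚ ℂ)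
      (PowerSeries.C (1 / 1728) * (u₄ ^ 3 + PowerSeries.C (-1) * u₆ ^ 2))) := by
    have := (HasQSeries.const (1 / 1728) h).mul ((hu₄.pow 3).add
      ((HasQSeries.const (-1) h).mul (hu₆.pow 2)))
    simp only [map_mul, map_add, map_pow, PowerSeries.map_C]
    convert this using 1
    · ext τ
      rw [discriminant_eq_E₄_cube_sub_E₆_sq]
      simp only [Pi.mul_apply, Pi.add_apply, Pi.pow_apply]
      ring
    · simp
  refine ⟨_, ?_, fun h0 => ?_, hΔ⟩
  · simp [h₄, h₆]
  · rw [h0, map_zero] at hΔ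
    obtain ⟨B, hB⟩ := hΔ
    obtain ⟨τ, h₁, h₂⟩ := ((frequently_atImInfty_of_eventually_codiscrete hB).and_eventually
      ((atImInfty_mem _).mpr ⟨B + 1, fun z hz => hz⟩)).exists
    refine discriminant_ne_zero τ ((h₁ (lt_of_lt_of_le (lt_add_one B) h₂)).unique ?_)
    simp

/-- The `j`-invariant, normalised as `E₄³ / Δ`. -/
noncomputable def jInvariant (τ : ℍ) : ℂ := E₄ τ ^ 3 / Δ τ

theorem mdifferentiable_discriminant : MDiff Δ := CuspForm.discriminant.holo'

theorem mdifferentiable_jInvariant : MDiff jInvariant :=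
  (E₄.holo'.pow 3).div mdifferentiable_discriminant discriminant_ne_zero

theorem discriminant_smul (γ : SL(2, ℤ)) (τ : ℍ) : Δ (γ • τ) = denom γ τ ^ 12 * Δ τ := by
  have := SlashInvariantForm.slash_action_eqn'' CuspForm.discriminant (γ := γ)
    (MonoidHom.mem_range.mpr ⟨γ, rfl⟩) τ
  exact_mod_cast this

theorem jInvariant_smul (γ : SL(2, ℤ)) (τ : ℍ) : jInvariant (γ • τ) = jInvariant τ := by
  have h₁ : E₄ (γ • τ) = denom γ τ ^ 4 * E₄ τ := by
    have := SlashInvariantForm.slash_action_eqn'' E₄ (γ := γ)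
      (MonoidHom.mem_range.mpr ⟨γ, rfl⟩) τ
    exact_mod_cast this
  rw [jInvariant, jInvariant, h₁, discriminant_smul]
  have h₂ := discriminant_ne_zero τ
  have h₃ := denom_ne_zero γ τ
  field_simp

theorem jInvariant_mul_discriminant (τ : ℍ) : jInvariant τ * Δ τ = E₄ τ ^ 3 :=
  div_mul_cancel₀ _ (discriminant_ne_zero τ)

theorem isBoundedAtImInfty_discriminant : IsBoundedAtImInfty Δ :=
  discriminant_isZeroAtImInfty.isBoundedAtImInfty

end UpperHalfPlane

/-! ### Level-one functions that cancel poles. -/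

namespace UpperHalfPlane

open Filter Topology Function ModularForm
open scoped Manifold

local notation "𝕢" => Periodic.qParam
local notation "Δ" => ModularForm.discriminant

/-- Nonzero holomorphic functions on `ℍ` that are invariant under `SL(2, ℤ)` and meromorphic
at `∞`. -/
structure IsLevelOneMultiplier (D : ℍ → ℂ) : Prop where
  mdifferentiable : MDiff D
  smul (γ : SL(2, ℤ)) (τ : ℍ) : D (γ • τ) = D τ
  ne_zero : D ≠ 0
  exists_bounded : ∃ d : ℕ, IsBoundedAtImInfty (D * Δ ^ d)

namespace IsLevelOneMultiplier

theorem one : IsLevelOneMultiplier 1 where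
  mdifferentiable := mdifferentiable_const
  smul _ _ := rfl
  ne_zero := one_ne_zero
  exists_bounded := ⟨0, by
    rw [pow_zero, mul_one]
    exact atImInfty.const_boundedAtFilter (1 : ℂ)⟩

theorem mul {D D' : ℍ → ℂ} (h : IsLevelOneMultiplier D) (h' : IsLevelOneMultiplier D') :
    IsLevelOneMultiplier (D * D') where
  mdifferentiable := h.mdifferentiable.mul h'.mdifferentiable
  smul γ τ := by rw [Pi.mul_apply, Pi.mul_apply, h.smul, h'.smul]
  ne_zero h0 := ((mul_eq_zero_iff h.mdifferentiable h'.mdifferentiable).mp h0).elim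
    h.ne_zero h'.ne_zero
  exists_bounded := by
    obtain ⟨d, hd⟩ := h.exists_bounded
    obtain ⟨d', hd'⟩ := h'.exists_bounded
    refine ⟨d + d', ?_⟩
    rw [show D * D' * Δ ^ (d + d') = D * Δ ^ d * (D' * Δ ^ d') by ring]
    exact hd.mul hd'

theorem pow {D : ℍ → ℂ} (h : IsLevelOneMultiplier D) (n : ℕ) : IsLevelOneMultiplier (D ^ n) := by
  induction n with
  | zero => simpa using one
  | succ n ih => simpa only [pow_succ] using ih.mul h

/-- Both nonvanishing and boundedness use `(j - c) Δ = E₄³ - c Δ`, a series with constant term `1`.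
-/
theorem jInvariant_sub_const (c : ℂ) : IsLevelOneMultiplier (jInvariant - fun _ => c) where
  mdifferentiable := mdifferentiable_jInvariant.sub mdifferentiable_const
  smul γ τ := by rw [Pi.sub_apply, Pi.sub_apply, jInvariant_smul]
  ne_zero h0 := by
    obtain ⟨u, hu, hE⟩ := exists_hasQSeries_E (k := 4) (by norm_num) ⟨2, rfl⟩ one_pos
    obtain ⟨v, hv, -, hΔ⟩ := exists_hasQSeries_discriminant one_pos
    have := ((hE.pow 3).add ((HasQSeries.const (-c) 1).mul hΔ)).eq_zero one_pos
      (.of_forall fun τ => by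
        have h₁ : jInvariant τ - c = 0 := congrFun h0 τ
        have h₂ := jInvariant_mul_discriminant τ
        simp only [Pi.add_apply, Pi.mul_apply, Pi.pow_apply, Pi.zero_apply]
        linear_combination (-1 : ℂ) * h₂ + Δ τ * h₁)
    replace this := congrArg PowerSeries.constantCoeff this
    rw [← map_pow] at this
    simp only [map_add, map_mul, ← PowerSeries.coeff_zero_eq_constantCoeff_apply,
      PowerSeries.coeff_map, map_zero] at this
    simp [hu, hv] at this
  exists_bounded := by
    refine ⟨1, ?_⟩
    have h₁ : (jInvariant - fun _ => c) * Δ ^ 1 = (E₄ : ℍ → ℂ) ^ 3 - (fun _ => c) * Δ := by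
      ext τ
      simp only [Pi.mul_apply, Pi.sub_apply, Pi.pow_apply, pow_one, ← jInvariant_mul_discriminant]
      ring
    rw [h₁]
    have h₂ : IsBoundedAtImInfty (E₄ : ℍ → ℂ) := ModularFormClass.bdd_at_infty E₄
    rw [pow_three, sub_eq_add_neg]
    exact (h₂.mul (h₂.mul h₂)).add
      ((atImInfty.const_boundedAtFilter c).mul isBoundedAtImInfty_discriminant).neg_left

end IsLevelOneMultiplier

/-- Since `j - j(τ)` vanishes at `τ`, its `n`-th power cancels a pole of order at most `n`. Allowing
all `n ≥ m` lets one exponent serve several functions. -/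
theorem exists_hasHoloExtensionAt_jInvariant_sub_pow_mul {f : ℍ → ℂ} {τ : ℍ}
    (hf : MeromorphicAt (fun z : ℂ => f (ofComplex z)) τ) :
    ∃ m : ℕ, ∀ n ≥ m, HasHoloExtensionAt ((jInvariant - fun _ => jInvariant τ) ^ n * f) τ := by
  obtain ⟨m, hm⟩ := hf
  have hj : AnalyticAt ℂ ((jInvariant - fun _ => jInvariant τ) ∘ ofComplex) (τ : ℂ) :=
    (mdifferentiable_iff.mp
      (IsLevelOneMultiplier.jInvariant_sub_const (jInvariant τ)).mdifferentiable).analyticAt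
      (isOpen_upperHalfPlaneSet.mem_nhds τ.im_pos)
  have hj0 : ((jInvariant - fun _ => jInvariant τ) ∘ ofComplex) (τ : ℂ) = 0 := by simp
  obtain ⟨e, he, hje⟩ := (natCast_le_analyticOrderAt (n := 1) hj).mp (by
    rw [Nat.cast_one, Order.one_le_iff_ne_zero]
    exact hj.analyticOrderAt_ne_zero.mpr hj0)
  refine ⟨m, fun n hn => ?_⟩
  refine ⟨fun z => e z ^ n * (z - τ) ^ (n - m) * ((z - τ) ^ m • f (ofComplex z)),
    ((he.pow n).mul ((analyticAt_id.sub analyticAt_const).pow _)).mul hm, ?_⟩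
  filter_upwards [(continuous_coe.continuousAt.eventually hje).filter_mono nhdsWithin_le_nhds]
    with z hz
  simp only [comp_apply, ofComplex_apply, pow_one, smul_eq_mul] at hz
  rw [Pi.mul_apply, Pi.pow_apply, hz, mul_pow, ofComplex_apply, smul_eq_mul,
    show n = n - m + m by omega, pow_add ((z : ℂ) - τ), Nat.add_sub_cancel]
  ring

end UpperHalfPlane

/-! ### Clearing the poles of all `f|γ` in `ℍ`. -/

open UpperHalfPlane Filter Topology
open scoped Manifold

theorem slashZero_mul (f : ℍ → ℂ) (γ γ' : SL(2, ℤ)) :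
    slashZero f (γ * γ') = slashZero (slashZero f γ) γ' := by
  ext τ
  simp only [slashZero, mul_smul]

theorem slashZero_eventuallyEq {f g : ℍ → ℂ} (h : f =ᶠ[codiscrete ℍ] g) (γ : SL(2, ℤ)) :
    slashZero f γ =ᶠ[codiscrete ℍ] slashZero g γ :=
  (tendsto_smul_codiscrete γ).eventually h

theorem Subgroup.FiniteIndex.exists_finset_mul {G : Type*} [Group G] {H : Subgroup G}
    (hH : H.FiniteIndex) : ∃ R : Finset G, ∀ g, ∃ r ∈ R, ∃ x ∈ H, g = x * r := by
  classical
  have : Fintype (G ⧸ H) := Fintype.ofFinite _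
  refine ⟨Finset.univ.image fun q : G ⧸ H => q.out⁻¹, fun g => ?_⟩
  refine ⟨_, Finset.mem_image_of_mem _ (Finset.mem_univ (QuotientGroup.mk g⁻¹)),
    g * (QuotientGroup.mk g⁻¹ : G ⧸ H).out, ?_, ?_⟩
  · simpa using QuotientGroup.eq.mp (QuotientGroup.out_eq' (QuotientGroup.mk g⁻¹ : G ⧸ H)).symm
  · group

namespace IsModularFunction

variable {Γ : Subgroup SL(2, ℤ)} {f : ℍ → ℂ}

theorem slashZero_mul_eventuallyEq (hf : IsModularFunction Γ f) {δ : SL(2, ℤ)} (hδ : δ ∈ Γ)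
    (γ : SL(2, ℤ)) : slashZero f (δ * γ) =ᶠ[codiscrete ℍ] slashZero f γ := by
  rw [slashZero_mul]
  exact slashZero_eventuallyEq (hf.invariant δ hδ) γ

theorem meromorphicAt_slashZero (hf : IsModularFunction Γ f) (γ : SL(2, ℤ)) (τ : ℍ) :
    MeromorphicAt (fun z : ℂ => slashZero f γ (ofComplex z)) τ := by
  let g : GL (Fin 2) ℝ := Matrix.SpecialLinearGroup.mapGL ℝ γ
  have hg : 0 < g.val.det := by
    rw [Matrix.SpecialLinearGroup.mapGL_coe_matrix, Matrix.SpecialLinearGroup.det_coe]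
    exact one_pos
  let G : ℂ → ℂ := fun z => ((g • ofComplex z : ℍ) : ℂ)
  have h₁ : MeromorphicAt (fun z : ℂ => f (ofComplex z)) (G τ) :=
    hf.meromorphic (G τ) (g • ofComplex τ).im_pos
  have h₂ := MeromorphicAt.comp_analyticAt (g := G) h₁ (UpperHalfPlane.analyticAt_smul hg τ)
  have h₃ : (fun z : ℂ => slashZero f γ (ofComplex z)) = (fun z => f (ofComplex z)) ∘ G := by
    funext z
    rw [Function.comp_apply, ofComplex_apply]
    rfl
  rw [h₃]
  exact h₂

/-- Only finitely many `f|r` matter, up to closed discrete sets. Their expansions exclude poles high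
in the fundamental domain, and the rest of it is compact, so a finite product of powers of `j -
j(τ)` suffices there. Invariance of `D` carries this to all of `ℍ`. -/
theorem exists_multiplier (hΓ : Γ.FiniteIndex) (hf : IsModularFunction Γ f) :
    ∃ D : ℍ → ℂ, IsLevelOneMultiplier D ∧
      ∀ (γ : SL(2, ℤ)) (τ : ℍ), HasHoloExtensionAt (D * slashZero f γ) τ := by
  obtain ⟨R, hR⟩ := hΓ.exists_finset_mul
  have hcusp : ∀ r : SL(2, ℤ), ∃ B : ℝ, ∀ τ : ℍ, B < τ.im →
      HasHoloExtensionAt (slashZero f r) τ := by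
    intro r
    obtain ⟨h, a, ha⟩ := hf.meromorphic_at_cusps r
    obtain ⟨N, p, -, -, hp⟩ := ha.exists_hasQSeries
    obtain ⟨B, hB⟩ := hp.hasHoloExtensionAt ha.1
    refine ⟨B, fun τ hτ => ?_⟩
    have hq : MDiff fun τ : ℍ => (Function.Periodic.qParam (h : ℝ) (τ : ℂ) ^ N)⁻¹ := by
      rw [UpperHalfPlane.mdifferentiable_iff]
      refine DifferentiableOn.congr (f := fun z => (Function.Periodic.qParam (h : ℝ) z ^ N)⁻¹)
        ?_ fun z hz => by simp [ofComplex_apply_of_im_pos hz]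
      exact ((Function.Periodic.differentiable_qParam.pow N).inv fun z =>
        pow_ne_zero _ (Function.Periodic.qParam_ne_zero _)).differentiableOn
    refine ((HasHoloExtensionAt.of_mdifferentiable hq τ).mul (hB τ hτ)).congr
      (.of_forall fun z => ?_)
    simp [Function.Periodic.qParam_ne_zero]
  choose B hB using hcusp
  obtain ⟨A, hA⟩ : ∃ A, ∀ r ∈ R, B r ≤ A :=
    ⟨∑ r ∈ R, |B r|, fun r hr => (le_abs_self _).trans
      (Finset.single_le_sum (fun i _ => abs_nonneg (B i)) hr)⟩
  have key : ∃ D : ℍ → ℂ, IsLevelOneMultiplier D ∧ ∀ r ∈ R,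
      ∀ τ ∈ ModularGroup.truncatedFundamentalDomain A,
        HasHoloExtensionAt (D * slashZero f r) τ := by
    refine (ModularGroup.isCompact_truncatedFundamentalDomain A).induction_on
      (p := fun S => ∃ D : ℍ → ℂ, IsLevelOneMultiplier D ∧ ∀ r ∈ R, ∀ τ ∈ S,
        HasHoloExtensionAt (D * slashZero f r) τ) ?_ ?_ ?_ ?_
    · exact ⟨1, .one, by simp⟩
    · rintro S T hST ⟨D, hD, h⟩
      exact ⟨D, hD, fun r hr τ hτ => h r hr τ (hST hτ)⟩
    · rintro S T ⟨D, hD, h⟩ ⟨D', hD', h'⟩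
      refine ⟨D * D', hD.mul hD', fun r hr τ hτ => ?_⟩
      rcases hτ with hτ | hτ
      · rw [mul_comm D, mul_assoc]
        exact (HasHoloExtensionAt.of_mdifferentiable hD'.mdifferentiable τ).mul (h r hr τ hτ)
      · rw [mul_assoc]
        exact (HasHoloExtensionAt.of_mdifferentiable hD.mdifferentiable τ).mul (h' r hr τ hτ)
    · intro τ _
      choose m hm using fun r => exists_hasHoloExtensionAt_jInvariant_sub_pow_mul
        (hf.meromorphicAt_slashZero r τ)
      have hn := fun r (hr : r ∈ R) => hm r (R.sup m) (Finset.le_sup hr)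
      -- Extendability is an open condition, so the multiplier chosen at `τ` works on a
      -- neighbourhood.
      have hev := (Filter.eventually_all_finset R).mpr fun r hr => (hn r hr).eventually_nhds
      exact ⟨_, mem_nhdsWithin_of_mem_nhds hev, _,
        (IsLevelOneMultiplier.jInvariant_sub_const (jInvariant τ)).pow (R.sup m),
        fun r hr z hz => hz r hr⟩
  obtain ⟨D, hD, hDR⟩ := key
  have hfd : ∀ (γ : SL(2, ℤ)), ∀ τ ∈ ModularGroup.fd,
      HasHoloExtensionAt (D * slashZero f γ) τ := by
    intro γ τ hτ
    obtain ⟨r, hr, δ, hδ, rfl⟩ := hR γ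
    refine HasHoloExtensionAt.congr (f := D * slashZero f r) ?_
      (EventuallyEq.rfl.mul (hf.slashZero_mul_eventuallyEq hδ r).symm)
    rcases le_or_gt τ.im A with h | h
    · exact hDR r hr τ ⟨hτ, h⟩
    · exact (HasHoloExtensionAt.of_mdifferentiable hD.mdifferentiable τ).mul
        (hB r τ ((hA r hr).trans_lt h))
  refine ⟨D, hD, fun γ τ => ?_⟩
  obtain ⟨g, hg⟩ := ModularGroup.exists_smul_mem_fd τ
  have := (hfd (γ * g⁻¹) (g • τ) hg).comp_smul
  refine this.congr (.of_forall fun z => ?_)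
  simp only [Pi.mul_apply, hD.smul, slashZero, mul_smul, inv_smul_smul]

end IsModularFunction

/-! ### Growth at the cusps and a vanishing criterion. -/

open UpperHalfPlane Filter Topology ModularForm
open scoped Manifold

theorem norm_le_of_eventually_codiscrete {G : ℍ → ℂ} (hG : MDiff G) {b : ℍ → ℝ}
    (hb : Continuous b) {B : ℝ} (h : ∀ᶠ τ : ℍ in codiscrete ℍ, B < τ.im → ‖G τ‖ ≤ b τ) (τ : ℍ)
    (hτ : B < τ.im) : ‖G τ‖ ≤ b τ := by
  refine le_of_tendsto_of_tendsto (b := 𝓝[≠] τ)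
    (hG.continuous.norm.continuousAt.tendsto.mono_left nhdsWithin_le_nhds)
    (hb.continuousAt.tendsto.mono_left nhdsWithin_le_nhds) ?_
  filter_upwards [eventually_codiscrete_iff.mp h τ,
    (continuous_im.continuousAt.eventually (lt_mem_nhds hτ)).filter_mono nhdsWithin_le_nhds]
    with z h₁ h₂ using h₁ h₂

theorem mdifferentiable_slashZero {F : ℍ → ℂ} (hF : MDiff F) (γ : SL(2, ℤ)) :
    MDiff (slashZero F γ) := by
  have hg : 0 < (Matrix.SpecialLinearGroup.mapGL ℝ γ).val.det := by
    rw [Matrix.SpecialLinearGroup.mapGL_coe_matrix, Matrix.SpecialLinearGroup.det_coe]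
    exact one_pos
  exact hF.comp (mdifferentiable_smul hg)

theorem isBoundedAtImInfty_discriminant_pow (n : ℕ) :
    IsBoundedAtImInfty (ModularForm.discriminant ^ n) := by
  induction n with
  | zero =>
    rw [pow_zero]
    exact atImInfty.const_boundedAtFilter (1 : ℂ)
  | succ n ih =>
    rw [pow_succ]
    exact ih.mul isBoundedAtImInfty_discriminant

/-- Here `Δ = O(q₁)` and `|q₁| ≤ |q_h|`; thus `Δ ^ N` absorbs a pole of order `N` in `q_h`. -/
theorem discriminant_isBigO_qParam {h : ℕ} (hh : 0 < h) :
    ModularForm.discriminant =O[atImInfty]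
      fun τ : ℍ => Function.Periodic.qParam (h : ℝ) (τ : ℂ) := by
  have h₁ := CuspFormClass.exp_decay_atImInfty (h := 1) CuspForm.discriminant one_pos
    one_mem_strictPeriods_SL
  refine h₁.trans (Asymptotics.IsBigO.of_bound 1 (.of_forall fun τ => ?_))
  rw [Function.Periodic.norm_qParam, Real.norm_eq_abs, Real.abs_exp, one_mul, Real.exp_le_exp, coe_im]
  have h₂ : (1 : ℝ) ≤ h := Nat.one_le_cast.mpr hh
  have h₃ := τ.im_pos
  rw [div_one, le_div_iff₀ (by linarith)]
  nlinarith [mul_nonneg (mul_nonneg Real.pi_pos.le h₃.le) (sub_nonneg.mpr h₂)]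

/-- `F` is the holomorphic version of `D f`. A power of `Δ` bounds each `F|γ` at `∞`, and one
exponent `e` is enough because `F|γ` depends only on the coset `Γγ`. -/
theorem IsModularFunction.exists_holomorphic_multiple {Γ : Subgroup SL(2, ℤ)} {f : ℍ → ℂ}
    (hΓ : Γ.FiniteIndex) (hf : IsModularFunction Γ f) :
    ∃ (D F : ℍ → ℂ) (e : ℕ), IsLevelOneMultiplier D ∧ MDiff F ∧
      (∀ γ, D * slashZero f γ =ᶠ[codiscrete ℍ] slashZero F γ) ∧
      (∀ δ ∈ Γ, slashZero F δ = F) ∧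
      IsBoundedAtImInfty (D * ModularForm.discriminant ^ e) ∧
      ∀ γ, IsBoundedAtImInfty (slashZero F γ * ModularForm.discriminant ^ e) := by
  obtain ⟨D, hD, hDf⟩ := hf.exists_multiplier hΓ
  obtain ⟨F, hF, hDF⟩ := HasHoloExtensionAt.exists_mdifferentiable (hDf 1)
  have hDF' : ∀ γ, D * slashZero f γ =ᶠ[codiscrete ℍ] slashZero F γ := by
    intro γ
    filter_upwards [slashZero_eventuallyEq hDF γ] with τ hτ
    rw [← hτ]
    simp only [slashZero, Pi.mul_apply, hD.smul, one_smul]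
  have hinv : ∀ δ ∈ Γ, slashZero F δ = F := by
    intro δ hδ
    refine eq_of_eventuallyEq_codiscrete (mdifferentiable_slashZero hF δ) hF ?_
    refine (hDF' δ).symm.trans (EventuallyEq.trans ?_ hDF.symm.symm)
    refine EventuallyEq.rfl.mul ?_
    simpa using hf.slashZero_mul_eventuallyEq hδ 1
  obtain ⟨d, hd⟩ := hD.exists_bounded
  have hmono : ∀ {G : ℍ → ℂ} {m n : ℕ}, m ≤ n →
      IsBoundedAtImInfty (G * ModularForm.discriminant ^ m) →
      IsBoundedAtImInfty (G * ModularForm.discriminant ^ n) := by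
    intro G m n hmn hG
    obtain ⟨k, rfl⟩ := Nat.exists_eq_add_of_le hmn
    rw [pow_add, ← mul_assoc]
    exact hG.mul (isBoundedAtImInfty_discriminant_pow k)
  have hbdd : ∀ r, ∃ n, IsBoundedAtImInfty (slashZero F r * ModularForm.discriminant ^ n) := by
    intro r
    obtain ⟨h, a, ha⟩ := hf.meromorphic_at_cusps r
    obtain ⟨N, p, -, -, hp⟩ := ha.exists_hasQSeries
    obtain ⟨B, C, hBC⟩ := hp.norm_le ha.1 (M := 0) (by simp)
    obtain ⟨C₁, hC₁, hd₁⟩ := (discriminant_isBigO_qParam ha.1).exists_nonneg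
    obtain ⟨B₁, hB₁⟩ := (atImInfty_mem _).mp hd₁.bound
    obtain ⟨C₂, B₂, hB₂⟩ := isBoundedAtImInfty_iff.mp hd
    refine ⟨d + N, isBoundedAtImInfty_iff.mpr ⟨C₂ * (C * C₁ ^ N), max (max B B₁) B₂ + 1, ?_⟩⟩
    intro τ hτ
    refine norm_le_of_eventually_codiscrete (b := fun _ => C₂ * (C * C₁ ^ N))
      ((mdifferentiable_slashZero hF r).mul (mdifferentiable_discriminant.pow _))
      continuous_const ?_ τ (lt_of_lt_of_le (lt_add_one _) hτ)
    filter_upwards [hBC, hDF' r] with z h₁ h₂ h₃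
    have hz₁ : B < z.im := ((le_max_left _ _).trans (le_max_left _ _)).trans_lt h₃
    have hz₂ : B₁ < z.im := ((le_max_right _ _).trans (le_max_left _ _)).trans_lt h₃
    have hz₃ : B₂ < z.im := (le_max_right _ _).trans_lt h₃
    have k₁ := h₁ hz₁
    have k₂ := hB₁ z hz₂.le
    have k₃ := hB₂ z hz₃.le
    simp only [Set.mem_ofPred_eq] at k₂
    rw [pow_zero, mul_one, norm_mul, norm_pow] at k₁
    have k₄ : 0 ≤ C₂ := (norm_nonneg _).trans k₃
    rw [Pi.mul_apply, ← h₂, Pi.mul_apply, Pi.pow_apply, pow_add]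
    calc ‖D z * slashZero f r z * (ModularForm.discriminant z ^ d * ModularForm.discriminant z ^ N)‖
        = ‖(D * ModularForm.discriminant ^ d) z‖ *
          (‖slashZero f r z‖ * ‖ModularForm.discriminant z‖ ^ N) := by
          simp only [Pi.mul_apply, Pi.pow_apply, norm_mul, norm_pow]
          ring
      _ ≤ C₂ * (‖slashZero f r z‖ * (C₁ * ‖Function.Periodic.qParam (h : ℝ) (z : ℂ)‖) ^ N) := by
          gcongr
      _ = C₂ * ((‖Function.Periodic.qParam (h : ℝ) (z : ℂ)‖ ^ N * ‖slashZero f r z‖) * C₁ ^ N) := by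
          ring
      _ ≤ C₂ * (C * C₁ ^ N) := by
          gcongr
  choose n hn using hbdd
  obtain ⟨R, hR⟩ := hΓ.exists_finset_mul
  refine ⟨D, F, max d (R.sup n), hD, hF, hDF', hinv, hmono (le_max_left _ _) hd, fun γ => ?_⟩
  obtain ⟨r, hr, δ, hδ, rfl⟩ := hR γ
  rw [slashZero_mul, hinv δ hδ]
  exact hmono ((Finset.le_sup hr).trans (le_max_right _ _)) (hn r)

theorem slash_mul_discriminant_pow (G : ℍ → ℂ) (N : ℕ) (γ : SL(2, ℤ)) :
    (G * ModularForm.discriminant ^ N) ∣[(12 * N : ℤ)] γ =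
      slashZero G γ * ModularForm.discriminant ^ N := by
  ext τ
  rw [SL_slash_apply, Pi.mul_apply, Pi.mul_apply, Pi.pow_apply, Pi.pow_apply, discriminant_smul,
    mul_pow, zpow_neg, ← pow_mul, slashZero]
  have := denom_ne_zero γ τ
  rw [show (12 * N : ℤ) = ((12 * N : ℕ) : ℤ) by push_cast; rfl, zpow_natCast]
  field_simp

/-- A substitute for the valence formula. The norm of `G Δ ^ N` has weight `12 N` times the index.
Its identity factor is `O(Δ ^ r)` and the others are bounded, so division by `Δ ^ r` gives a
level-one form of negative weight. -/
theorem eq_zero_of_isBigO_discriminant_pow {Γ : Subgroup SL(2, ℤ)} (hΓ : Γ.FiniteIndex)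
    {G : ℍ → ℂ} (hG : MDiff G) (hinv : ∀ δ ∈ Γ, slashZero G δ = G) {N r : ℕ}
    (hb : ∀ γ, IsBoundedAtImInfty (slashZero G γ * ModularForm.discriminant ^ N))
    (hr : N * Nat.card (𝒮ℒ ⧸ (Γ.map (Matrix.SpecialLinearGroup.mapGL ℝ)).subgroupOf 𝒮ℒ) < r)
    (hO : (G * ModularForm.discriminant ^ N) =O[atImInfty] (ModularForm.discriminant ^ r)) :
    G = 0 := by
  set 𝒢 := Γ.map (Matrix.SpecialLinearGroup.mapGL ℝ) with h𝒢
  have : 𝒢.IsArithmetic := inferInstance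
  let φ : ModularForm 𝒢 (12 * N) :=
    { toFun := G * ModularForm.discriminant ^ N
      slash_action_eq' := by
        rintro _ ⟨γ, hγ, rfl⟩
        exact (slash_mul_discriminant_pow G N γ).trans (by rw [hinv γ hγ])
      holo' := hG.mul (mdifferentiable_discriminant.pow N)
      bdd_at_cusps' := by
        intro c hc
        rw [Subgroup.IsArithmetic.isCusp_iff_isCusp_SL2Z] at hc
        rw [OnePoint.isBoundedAt_iff_forall_SL2Z hc]
        intro γ _
        rw [slash_mul_discriminant_pow]
        exact hb γ }
  have hφ : ⇑φ = G * ModularForm.discriminant ^ N := rfl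
  obtain ⟨_, hcoe⟩ : ∃ _ : Fintype (𝒮ℒ ⧸ 𝒢.subgroupOf 𝒮ℒ), (ModularForm.norm 𝒮ℒ φ : ℍ → ℂ) =
      ∏ q, SlashInvariantForm.quotientFunc (ℋ := 𝒮ℒ) φ q :=
    ⟨Fintype.ofFinite _, ModularForm.coe_norm 𝒮ℒ φ⟩
  have hnO : (ModularForm.norm 𝒮ℒ φ : ℍ → ℂ) =O[atImInfty] (ModularForm.discriminant ^ r) := by
    classical
    have hq : ∀ q, IsBoundedAtImInfty (SlashInvariantForm.quotientFunc (ℋ := 𝒮ℒ) φ q) := by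
      refine Quotient.forall.mpr ?_
      rintro ⟨_, γ, rfl⟩
      rw [SlashInvariantForm.quotientFunc_mk, ← map_inv, hφ]
      change IsBoundedAtImInfty ((G * ModularForm.discriminant ^ N) ∣[(12 * N : ℤ)] γ⁻¹)
      rw [slash_mul_discriminant_pow]
      exact hb γ⁻¹
    have h1' : SlashInvariantForm.quotientFunc (ℋ := 𝒮ℒ) φ ((1 : 𝒮ℒ) : 𝒮ℒ ⧸ 𝒢.subgroupOf 𝒮ℒ) =
        G * ModularForm.discriminant ^ N := by
      refine (SlashInvariantForm.quotientFunc_mk φ (1 : 𝒮ℒ)).trans ?_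
      rw [OneMemClass.coe_one, inv_one, SlashAction.slash_one]
      rfl
    rw [hcoe, ← Finset.mul_prod_erase Finset.univ _
      (Finset.mem_univ ((1 : 𝒮ℒ) : 𝒮ℒ ⧸ 𝒢.subgroupOf 𝒮ℒ)), h1']
    have h2 : IsBoundedAtImInfty
        (∏ q ∈ Finset.univ.erase ((1 : 𝒮ℒ) : 𝒮ℒ ⧸ 𝒢.subgroupOf 𝒮ℒ),
          SlashInvariantForm.quotientFunc (ℋ := 𝒮ℒ) φ q) :=
      Finset.prod_induction _ IsBoundedAtImInfty (fun _ _ ha hb => ha.mul hb)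
        (atImInfty.const_boundedAtFilter (1 : ℂ)) fun q _ => hq q
    have h3 : (1 : ℍ → ℝ) =O[atImInfty] (1 : ℍ → ℂ) :=
      Asymptotics.IsBigO.of_bound 1 (.of_forall fun τ => by simp)
    have h4 := hO.mul (Asymptotics.IsBigO.trans h2 h3)
    refine h4.trans (Asymptotics.IsBigO.of_bound 1 (.of_forall fun τ => ?_))
    simp
  have hslash : ∀ γ : SL(2, ℤ), (ModularForm.norm 𝒮ℒ φ / ModularForm.discriminant ^ r)
      ∣[(12 * N * Nat.card (𝒮ℒ ⧸ 𝒢.subgroupOf 𝒮ℒ) - 12 * r : ℤ)] γ =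
      ModularForm.norm 𝒮ℒ φ / ModularForm.discriminant ^ r := by
    intro γ
    have hγ : (γ : GL (Fin 2) ℝ) ∈ 𝒮ℒ := ⟨γ, rfl⟩
    have h1 := slash_mul_discriminant_pow 1 r γ
    have h2 : slashZero 1 γ = 1 := rfl
    rw [h2, one_mul] at h1
    rw [div_slash_SL2, h1, SL_slash, SlashInvariantFormClass.slash_action_eq _ _ hγ]
  let ψ : ModularForm 𝒮ℒ (12 * N * Nat.card (𝒮ℒ ⧸ 𝒢.subgroupOf 𝒮ℒ) - 12 * r) :=
    { toFun := ModularForm.norm 𝒮ℒ φ / ModularForm.discriminant ^ r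
      slash_action_eq' := fun _ ⟨γ, hγ⟩ => hγ ▸ hslash γ
      holo' := (ModularForm.norm 𝒮ℒ φ).holo'.div (mdifferentiable_discriminant.pow r)
        fun τ => pow_ne_zero _ (discriminant_ne_zero τ)
      bdd_at_cusps' := by
        intro c hc
        rw [Subgroup.IsArithmetic.isCusp_iff_isCusp_SL2Z] at hc
        rw [OnePoint.isBoundedAt_iff_forall_SL2Z hc]
        intro γ _
        rw [hslash]
        exact (Asymptotics.div_isBoundedUnder_of_isBigO hnO).isBigO_one ℝ }
  have hψ : ψ = 0 := ModularForm.isZero_of_neg_weight (by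
    have : (N * Nat.card (𝒮ℒ ⧸ 𝒢.subgroupOf 𝒮ℒ) : ℤ) < r := by exact_mod_cast hr
    linarith) ψ
  have hn : ModularForm.norm 𝒮ℒ φ = 0 := by
    ext τ
    have h₁ : ModularForm.norm 𝒮ℒ φ τ / ModularForm.discriminant τ ^ r = 0 := DFunLike.congr_fun hψ τ
    exact (div_eq_zero_iff.mp h₁).resolve_right (pow_ne_zero _ (discriminant_ne_zero τ))
  rw [ModularForm.norm_eq_zero_iff, hφ] at hn
  ext τ
  exact (mul_eq_zero.mp (congrFun hn τ)).resolve_right (pow_ne_zero _ (discriminant_ne_zero τ))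

/-! ### The algebraic relation between `f` and `j` over `K`. -/

theorem PowerSeries.exists_coeff_sum_eq_zero {K ι : Type*} [Field K] (T : Finset ι)
    (s : ι → PowerSeries K) {M : ℕ} (hM : M < T.card) :
    ∃ c : ι → K, (∃ x ∈ T, c x ≠ 0) ∧
      ∀ m < M, (∑ x ∈ T, PowerSeries.C (c x) * s x).coeff m = 0 := by
  classical
  let L := (Matrix.of fun (m : Fin M) (x : T) => (s x).coeff m).mulVecLin
  have hL : LinearMap.ker L ≠ ⊥ := LinearMap.ker_ne_bot_of_finrank_lt (by simpa using hM)
  obtain ⟨v, hv, hv0⟩ := (Submodule.ne_bot_iff _).mp hL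
  obtain ⟨x, hx⟩ := Function.ne_iff.mp hv0
  refine ⟨fun x => if h : x ∈ T then v ⟨x, h⟩ else 0, ⟨x, x.2, by simpa using hx⟩, fun m hm => ?_⟩
  have h := congrFun (LinearMap.mem_ker.mp hv) ⟨m, hm⟩
  rw [map_sum, ← Finset.sum_coe_sort]
  simp only [L, Matrix.mulVecLin_apply, Matrix.mulVec, dotProduct, Matrix.of_apply,
    Pi.zero_apply] at h
  refine Eq.trans (Finset.sum_congr rfl fun x _ => ?_) h
  simp only [PowerSeries.coeff_C_mul, x.2, dite_true]
  exact mul_comm _ _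

/-- Transcendence of `W / V`, applied to `j = E₄³ / Δ`: constant terms give `c A = 0`, then a factor
`V` cancels and the degree drops. -/
theorem PowerSeries.eq_zero_of_sum_homogeneous_eq_zero {K : Type*} [Field K] {V W : PowerSeries K}
    (hV : V ≠ 0) (hV0 : constantCoeff V = 0) (hW : constantCoeff W = 1) (A : ℕ) {c : ℕ → K}
    (h : ∑ k ∈ Finset.range (A + 1), C (c k) * (W ^ k * V ^ (A - k)) = 0) :
    ∀ k ≤ A, c k = 0 := by
  have htop : ∀ A : ℕ, ∑ k ∈ Finset.range A, C (c k) * (W ^ k * V ^ (A - k)) =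
      V * ∑ k ∈ Finset.range A, C (c k) * (W ^ k * V ^ (A - 1 - k)) := by
    intro A
    rw [Finset.mul_sum]
    refine Finset.sum_congr rfl fun k hk => ?_
    have := Finset.mem_range.mp hk
    rw [show A - k = (A - 1 - k) + 1 by omega, pow_succ]
    ring
  have hc : ∀ A : ℕ, ∑ k ∈ Finset.range (A + 1), C (c k) * (W ^ k * V ^ (A - k)) = 0 →
      c A = 0 := by
    intro A h
    rw [Finset.sum_range_succ, htop] at h
    simpa [hV0, hW] using congrArg constantCoeff h
  induction A with
  | zero =>
    intro k hk
    obtain rfl := Nat.le_zero.mp hk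
    exact hc 0 h
  | succ A ih =>
    intro k hk
    have hA := hc _ h
    rcases Nat.le_succ_iff.mp hk with hk | rfl
    · refine ih ?_ k hk
      rw [Finset.sum_range_succ, hA, map_zero, zero_mul, add_zero, htop] at h
      exact (mul_eq_zero.mp h).resolve_left hV
    · exact hA

open UpperHalfPlane Filter Topology ModularForm
open scoped Manifold

/-- The factor `q ^ (N * A)` clears the poles of all `g ^ i` with `i ≤ A`; a factor `Δ ^ A` has
already turned `j ^ k` into `E₄ ^ (3k) Δ ^ (A - k)`. -/
theorem UpperHalfPlane.HasQSeries.sum_monomials {g : ℍ → ℂ} {h N : ℕ} {p u v : PowerSeries ℂ}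
    (hg : HasQSeries (fun τ => Function.Periodic.qParam (h : ℝ) (τ : ℂ) ^ N * g τ) h p)
    (hu : HasQSeries E₄ h u) (hv : HasQSeries ModularForm.discriminant h v) (A : ℕ)
    {T : Finset (ℕ × ℕ)} (hT : ∀ x ∈ T, x.1 ≤ A) (c : ℕ × ℕ → ℂ) :
    HasQSeries (fun τ => Function.Periodic.qParam (h : ℝ) (τ : ℂ) ^ (N * A) *
        ∑ x ∈ T, c x * (g τ ^ x.1 * ((E₄ τ ^ 3) ^ x.2 * ModularForm.discriminant τ ^ (A - x.2))))
      h (∑ x ∈ T, PowerSeries.C (c x) *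
        (p ^ x.1 * PowerSeries.X ^ (N * (A - x.1)) * ((u ^ 3) ^ x.2 * v ^ (A - x.2)))) := by
  refine (HasQSeries.sum fun x _ => (HasQSeries.const (c x) h).mul
    (((hg.pow x.1).mul (HasQSeries.qParam_pow h (N * (A - x.1)))).mul
      (((hu.pow 3).pow x.2).mul (hv.pow (A - x.2))))).congr (.of_forall fun τ => ?_)
  simp only [Finset.sum_apply, Finset.mul_sum]
  refine Finset.sum_congr rfl fun x hx => ?_
  simp only [Pi.mul_apply, Pi.pow_apply]
  obtain ⟨k, hk⟩ := Nat.exists_eq_add_of_le (hT x hx)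
  rw [show A - x.1 = k by omega, show N * A = N * x.1 + N * k by rw [hk]; ring, pow_add, pow_mul]
  ring

theorem UpperHalfPlane.IsBoundedAtImInfty.pow {G : ℍ → ℂ} (hG : IsBoundedAtImInfty G) (n : ℕ) :
    IsBoundedAtImInfty (G ^ n) := by
  induction n with
  | zero =>
    rw [pow_zero]
    exact atImInfty.const_boundedAtFilter (1 : ℂ)
  | succ n ih =>
    rw [pow_succ]
    exact ih.mul hG

theorem isBoundedAtImInfty_sum_monomials {D F : ℍ → ℂ} {e : ℕ}
    (hD : IsBoundedAtImInfty (D * ModularForm.discriminant ^ e))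
    (hF : IsBoundedAtImInfty (F * ModularForm.discriminant ^ e)) (A : ℕ) {T : Finset (ℕ × ℕ)}
    (hT : ∀ x ∈ T, x.1 ≤ A ∧ x.2 ≤ A) (c : ℕ × ℕ → ℂ) :
    IsBoundedAtImInfty ((fun τ => ∑ x ∈ T, c x *
      (F τ ^ x.1 * D τ ^ (A - x.1) * jInvariant τ ^ x.2)) *
        ModularForm.discriminant ^ (e * A + A)) := by
  have hE : IsBoundedAtImInfty (E₄ : ℍ → ℂ) := ModularFormClass.bdd_at_infty E₄
  have h₁ : ∀ x : ℕ × ℕ, IsBoundedAtImInfty ((fun _ => c x) *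
      ((F * ModularForm.discriminant ^ e) ^ x.1 * (D * ModularForm.discriminant ^ e) ^ (A - x.1) *
      (((E₄ : ℍ → ℂ) ^ 3) ^ x.2 * ModularForm.discriminant ^ (A - x.2)))) := fun x =>
    (atImInfty.const_boundedAtFilter (c x)).mul (((hF.pow _).mul (hD.pow _)).mul
      (((hE.pow 3).pow _).mul (isBoundedAtImInfty_discriminant_pow _)))
  have h₂ : IsBoundedAtImInfty (∑ x ∈ T, (fun _ => c x) *
      ((F * ModularForm.discriminant ^ e) ^ x.1 * (D * ModularForm.discriminant ^ e) ^ (A - x.1) *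
      (((E₄ : ℍ → ℂ) ^ 3) ^ x.2 * ModularForm.discriminant ^ (A - x.2)))) :=
    Finset.sum_induction _ IsBoundedAtImInfty (fun _ _ ha hb => ha.add hb)
      (atImInfty.const_boundedAtFilter (0 : ℂ)) fun x _ => h₁ x
  convert h₂ using 1
  ext τ
  simp only [Finset.sum_apply, Pi.mul_apply, Finset.sum_mul, Pi.pow_apply]
  refine Finset.sum_congr rfl fun x hx => ?_
  obtain ⟨i, hi⟩ := Nat.exists_eq_add_of_le (hT x hx).1
  obtain ⟨k, hk⟩ := Nat.exists_eq_add_of_le (hT x hx).2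
  rw [← jInvariant_mul_discriminant, show A - x.1 = i by omega, show A - x.2 = k by omega,
    show e * A + A = e * x.1 + e * i + x.2 + k by rw [add_assoc, ← hk, hi]; ring]
  simp only [pow_add, pow_mul, mul_pow]
  ring

theorem IsModularFunction.exists_algebraic_relation {Γ : Subgroup SL(2, ℤ)} {f : ℍ → ℂ}
    (hΓ : Γ.FiniteIndex) (hf : IsModularFunction Γ f) {K : IntermediateField ℚ ℂ}
    (hfK : HasFourierCoeffsIn f K) :
    ∃ (A : ℕ) (c : ℕ × ℕ → K),
      (∃ x ∈ Finset.range (A + 1) ×ˢ Finset.range (A + 1), c x ≠ 0) ∧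
      ∀ᶠ τ in codiscrete ℍ, ∑ x ∈ Finset.range (A + 1) ×ˢ Finset.range (A + 1),
        (c x : ℂ) * (f τ ^ x.1 * jInvariant τ ^ x.2) = 0 := by
  obtain ⟨D, F, e, hD, hF, hDF, hinv, hDb, hFb⟩ := hf.exists_holomorphic_multiple hΓ
  obtain ⟨h, a, ha, haK⟩ := hfK
  obtain ⟨N₀, p, hpa, -, hp⟩ := ha.exists_hasQSeries
  have hh : 0 < h := ha.1
  obtain ⟨u, -, hu⟩ := exists_hasQSeries_E (k := 4) (by norm_num) ⟨2, rfl⟩ hh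
  obtain ⟨v, -, -, hv⟩ := exists_hasQSeries_discriminant hh
  set J := Nat.card (𝒮ℒ ⧸ (Γ.map (Matrix.SpecialLinearGroup.mapGL ℝ)).subgroupOf 𝒮ℒ) with hJ
  -- With this `A`, the number of conditions `N₀ A + h r` equals `A² - h A + h ≤ A²`, less than the
  -- `(A + 1)²` unknowns.
  obtain ⟨A, hA⟩ : ∃ A, A = N₀ + h * (e + 1) * J + h := ⟨_, rfl⟩
  -- The least order of vanishing that makes the weight of the quotient negative.
  set r := (e * A + A) * J + 1 with hr
  set T := Finset.range (A + 1) ×ˢ Finset.range (A + 1) with hT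
  have hTA : ∀ x ∈ T, x.1 ≤ A ∧ x.2 ≤ A := by
    intro x hx
    rw [hT, Finset.mem_product, Finset.mem_range, Finset.mem_range] at hx
    omega
  let pK : PowerSeries K := PowerSeries.mk fun m => ⟨a.coeff ((m : ℤ) - N₀), haK _⟩
  let uK := PowerSeries.map (algebraMap ℚ K) u
  let vK := PowerSeries.map (algebraMap ℚ K) v
  have hpK : PowerSeries.map (algebraMap K ℂ) pK = p := by
    ext m
    rw [PowerSeries.coeff_map, PowerSeries.coeff_mk, hpa]
    rfl
  have hmap : ∀ w : PowerSeries ℚ, PowerSeries.map (algebraMap K ℂ)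
      (PowerSeries.map (algebraMap ℚ K) w) = PowerSeries.map (algebraMap ℚ ℂ) w := by
    intro w
    ext m
    simp
  have hcard : N₀ * A + h * r < T.card := by
    rw [hT, Finset.card_product, Finset.card_range, hr]
    have : 1 ≤ A := by omega
    nlinarith [Nat.mul_le_mul_left h this]
  obtain ⟨c, hc, hcM⟩ := PowerSeries.exists_coeff_sum_eq_zero T (fun x => pK ^ x.1 *
    PowerSeries.X ^ (N₀ * (A - x.1)) * ((uK ^ 3) ^ x.2 * vK ^ (A - x.2))) hcard
  refine ⟨A, c, hc, ?_⟩
  have hφ := hp.sum_monomials hu hv A (fun x hx => (hTA x hx).1) fun x => (c x : ℂ)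
  obtain ⟨B, C, hBC⟩ := hφ.norm_le hh (M := N₀ * A + h * r) (by
    intro m hm
    have := congrArg (algebraMap K ℂ) (hcM m hm)
    rw [← PowerSeries.coeff_map, map_zero, map_sum] at this
    simpa only [map_mul, map_pow, PowerSeries.map_C, PowerSeries.map_X, hpK, uK, vK, hmap]
      using! this)
  -- The relation homogenised by `D ^ A`, which makes it holomorphic.
  let G : ℍ → ℂ := fun τ => ∑ x ∈ T, (c x : ℂ) *
      (F τ ^ x.1 * D τ ^ (A - x.1) * jInvariant τ ^ x.2)
  have hslash : ∀ γ, slashZero G γ = fun τ => ∑ x ∈ T, (c x : ℂ) *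
      (slashZero F γ τ ^ x.1 * D τ ^ (A - x.1) * jInvariant τ ^ x.2) := by
    intro γ
    ext τ
    simp only [slashZero, G, hD.smul, jInvariant_smul]
  have hGdiff : MDiff G := by
    have : G = ∑ x ∈ T, (fun _ => (c x : ℂ)) *
        (F ^ x.1 * D ^ (A - x.1) * jInvariant ^ x.2) := by
      ext τ
      simp [G]
    rw [this]
    exact MDifferentiable.sum fun x _ => mdifferentiable_const.mul
      (((hF.pow _).mul (hD.mdifferentiable.pow _)).mul (mdifferentiable_jInvariant.pow _))
  have hGD : ∀ᶠ τ in codiscrete ℍ, G τ =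
      D τ ^ A * ∑ x ∈ T, (c x : ℂ) * (f τ ^ x.1 * jInvariant τ ^ x.2) := by
    filter_upwards [hDF 1] with τ hτ
    simp only [Pi.mul_apply, slashZero, one_smul] at hτ
    simp only [G]
    rw [Finset.mul_sum]
    refine Finset.sum_congr rfl fun x hx => ?_
    obtain ⟨i, hi⟩ := Nat.exists_eq_add_of_le (hTA x hx).1
    rw [← hτ, show A - x.1 = i by omega, hi, mul_pow, pow_add]
    ring
  have hG : G = 0 := by
    refine eq_zero_of_isBigO_discriminant_pow hΓ hGdiff (N := e * A + A) (r := r) ?_ ?_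
      (Nat.lt_succ_self _) ?_
    · intro δ hδ
      rw [hslash, hinv δ hδ]
    · intro γ
      rw [hslash]
      exact isBoundedAtImInfty_sum_monomials hDb (hFb γ) A hTA fun x => (c x : ℂ)
    · obtain ⟨C₁, B₁, hB₁⟩ := isBoundedAtImInfty_iff.mp (hDb.pow A)
      have hexp := exp_isBigO_discriminant.pow r
      refine Asymptotics.IsBigO.trans (Asymptotics.IsBigO.of_bound (C₁ * C) ?_) hexp
      rw [Filter.Eventually, atImInfty_mem]
      refine ⟨max B B₁ + 1, fun τ hτ => ?_⟩
      refine norm_le_of_eventually_codiscrete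
        (b := fun τ => C₁ * C * ‖Real.exp (-2 * Real.pi * τ.im) ^ r‖)
        (hGdiff.mul (mdifferentiable_discriminant.pow _)) (by fun_prop) ?_ τ
        (lt_of_lt_of_le (lt_add_one _) hτ)
      filter_upwards [hBC, hGD] with z h₁ h₂ h₃
      have k₁ := h₁ ((le_max_left _ _).trans_lt h₃)
      have k₂ := hB₁ z ((le_max_right _ _).trans_lt h₃).le
      set q := Function.Periodic.qParam (h : ℝ) (z : ℂ) with hq
      have hq0 : 0 < ‖q‖ := norm_pos_iff.mpr (Function.Periodic.qParam_ne_zero _)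
      -- Of the `N₀ A + h r` orders of vanishing in `q_h`, the first `N₀ A` pay for the clearing
      -- factor; the other `h r` amount to order `r` in `q₁`, that is, `O(Δ ^ r)`.
      have hqexp : ‖q‖ ^ h = Real.exp (-2 * Real.pi * z.im) := by
        rw [hq, Function.Periodic.norm_qParam, ← Real.exp_nat_mul, coe_im]
        congr 1
        have : (h : ℝ) ≠ 0 := by exact_mod_cast hh.ne'
        field_simp
      rw [norm_mul, norm_pow, pow_add, pow_mul ‖q‖ h r, hqexp] at k₁
      set S := ∑ x ∈ T, (c x : ℂ) *
        (f z ^ x.1 * ((E₄ z ^ 3) ^ x.2 * ModularForm.discriminant z ^ (A - x.2))) with hS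
      have k₃ : ‖S‖ ≤ C * Real.exp (-2 * Real.pi * z.im) ^ r := by
        refine le_of_mul_le_mul_left (k₁.trans_eq ?_) (pow_pos hq0 (N₀ * A))
        ring
      have k₄ : (G * ModularForm.discriminant ^ (e * A + A)) z =
          ((D * ModularForm.discriminant ^ e) ^ A) z * S := by
        simp only [Pi.mul_apply, Pi.pow_apply]
        rw [h₂, hS, Finset.mul_sum, Finset.mul_sum, Finset.sum_mul]
        refine Finset.sum_congr rfl fun x hx => ?_
        obtain ⟨k, hk⟩ := Nat.exists_eq_add_of_le (hTA x hx).2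
        rw [← jInvariant_mul_discriminant, show A - x.2 = k by omega, pow_add, mul_pow, pow_mul,
          show ModularForm.discriminant z ^ A = ModularForm.discriminant z ^ (x.2 + k) by rw [← hk],
          pow_add, mul_pow]
        ring
      rw [k₄, norm_mul, Real.norm_of_nonneg (by positivity), mul_assoc]
      exact mul_le_mul k₂ k₃ (norm_nonneg _) ((norm_nonneg _).trans k₂)
  filter_upwards [hGD, eventually_ne_zero_codiscrete hD.mdifferentiable hD.ne_zero] with τ h₁ h₂
  rw [hG, Pi.zero_apply] at h₁
  exact (mul_eq_zero.mp h₁.symm).resolve_left (pow_ne_zero _ h₂)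

/-! ### Transfer to the other cusps. -/

theorem IsModularFunction.exists_numberField_hasFourierCoeffsIn {Γ : Subgroup SL(2, ℤ)}
    {f : ℍ → ℂ} (hΓ : Γ.FiniteIndex) (hf : IsModularFunction Γ f) {K : IntermediateField ℚ ℂ}
    (hK : NumberField K) (hfK : HasFourierCoeffsIn f K) (γ : SL(2, ℤ)) :
    ∃ K' : IntermediateField ℚ ℂ, NumberField K' ∧ K ≤ K' ∧
      HasFourierCoeffsIn (slashZero f γ) K' := by
  obtain ⟨A, c, ⟨⟨i₀, k₀⟩, hx₀, hc⟩, hrel⟩ := hf.exists_algebraic_relation hΓ hfK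
  rw [Finset.mem_product, Finset.mem_range, Finset.mem_range] at hx₀
  obtain ⟨h, a, ha⟩ := hf.meromorphic_at_cusps γ
  obtain ⟨N, p, hpa, ha0, hp⟩ := ha.exists_hasQSeries
  have hh : 0 < h := ha.1
  obtain ⟨u, hu1, hu⟩ := exists_hasQSeries_E (k := 4) (by norm_num) ⟨2, rfl⟩ hh
  obtain ⟨v, hv0, hv1, hv⟩ := exists_hasQSeries_discriminant hh
  have hφ := hp.sum_monomials hu hv A (T := Finset.range (A + 1) ×ˢ Finset.range (A + 1))
    (fun x hx => Nat.lt_succ_iff.mp (Finset.mem_range.mp (Finset.mem_product.mp hx).1))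
    fun x => (c x : ℂ)
  have hzero := hφ.eq_zero hh (by
    filter_upwards [(tendsto_smul_codiscrete γ).eventually hrel] with τ hτ
    rw [Pi.zero_apply, mul_eq_zero]
    right
    rw [← mul_zero (ModularForm.discriminant τ ^ A), ← hτ, Finset.mul_sum]
    refine Finset.sum_congr rfl fun x hx => ?_
    obtain ⟨k, hk⟩ := Nat.exists_eq_add_of_le (Nat.lt_succ_iff.mp
      (Finset.mem_range.mp (Finset.mem_product.mp hx).2))
    rw [jInvariant_smul, ← jInvariant_mul_discriminant, show A - x.2 = k by omega, mul_pow,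
      show ModularForm.discriminant τ ^ A = ModularForm.discriminant τ ^ (x.2 + k) by rw [← hk],
      pow_add, slashZero]
    ring)
  let uK := PowerSeries.map (algebraMap ℚ K) u
  let vK := PowerSeries.map (algebraMap ℚ K) v
  have hmap : ∀ w : PowerSeries ℚ, PowerSeries.map (algebraMap K ℂ)
      (PowerSeries.map (algebraMap ℚ K) w) = PowerSeries.map (algebraMap ℚ ℂ) w := by
    intro w
    ext m
    simp
  let Q : ℕ → PowerSeries K := fun i => ∑ k ∈ Finset.range (A + 1),
    PowerSeries.C (c (i, k)) * ((uK ^ 3) ^ k * vK ^ (A - k))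
  -- The relation times `q ^ (N * A) Δ ^ A`, as a polynomial in `p`, the expansion of `q ^ N f|γ`.
  let P : Polynomial (PowerSeries K) := ∑ i ∈ Finset.range (A + 1),
    Polynomial.monomial i (PowerSeries.X ^ (N * (A - i)) * Q i)
  have hP : P ≠ 0 := by
    intro h0
    have h1 := congrArg (fun P => P.coeff i₀) h0
    simp only [P, Polynomial.finsetSum_coeff, Polynomial.coeff_monomial, Polynomial.coeff_zero,
      Finset.sum_ite_eq', Finset.mem_range, hx₀.1, if_true] at h1
    have h2 := (mul_eq_zero.mp h1).resolve_left (pow_ne_zero _ PowerSeries.X_ne_zero)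
    refine hc (PowerSeries.eq_zero_of_sum_homogeneous_eq_zero (V := vK) (W := uK ^ 3) ?_ ?_ ?_ A
      (c := fun k => c (i₀, k)) h2 k₀ (Nat.lt_succ_iff.mp hx₀.2))
    · exact (map_ne_zero_iff _ (PowerSeries.map_injective _ (algebraMap ℚ K).injective)).mpr hv1
    · rw [← PowerSeries.coeff_zero_eq_constantCoeff_apply, PowerSeries.coeff_map,
        PowerSeries.coeff_zero_eq_constantCoeff_apply, hv0, map_zero]
    · rw [map_pow, ← PowerSeries.coeff_zero_eq_constantCoeff_apply, PowerSeries.coeff_map,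
        PowerSeries.coeff_zero_eq_constantCoeff_apply, hu1, map_one, one_pow]
  have hroot : P.eval₂ (PowerSeries.map (algebraMap K ℂ)) p = 0 := by
    rw [Polynomial.eval₂_finsetSum]
    rw [Finset.sum_product] at hzero
    refine Eq.trans (Finset.sum_congr rfl fun i _ => ?_) hzero
    simp only [Polynomial.eval₂_monomial, map_mul, map_pow, PowerSeries.map_X, Q, map_sum,
      PowerSeries.map_C, uK, vK, hmap]
    rw [Finset.mul_sum, Finset.sum_mul]
    refine Finset.sum_congr rfl fun k _ => ?_
    change _ * (PowerSeries.C (c (i, k) : ℂ) * _) * _ = _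
    ring
  obtain ⟨K', hK', hle, hcoeff⟩ := exists_numberField_coeff_mem_of_eval₂_eq_zero K hK hP hroot
  refine ⟨K', hK', hle, h, a, ha, fun n => ?_⟩
  rcases lt_or_ge n (-N) with hn | hn
  · rw [ha0 n hn]
    exact zero_mem _
  · have := hcoeff (n + N).toNat
    rwa [hpa, show (((n + N).toNat : ℕ) : ℤ) - N = n by omega] at this

theorem HasFourierCoeffsIn.congr {f g : ℍ → ℂ} {K : IntermediateField ℚ ℂ}
    (hf : HasFourierCoeffsIn f K) (h : f =ᶠ[codiscrete ℍ] g) : HasFourierCoeffsIn g K := by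
  obtain ⟨n, a, ⟨hn, B, hB⟩, ha⟩ := hf
  refine ⟨n, a, ⟨hn, B, ?_⟩, ha⟩
  filter_upwards [hB, h] with τ h₁ h₂ h₃
  rw [← h₂]
  exact h₁ h₃

theorem HasFourierCoeffsIn.mono {f : ℍ → ℂ} {K K' : IntermediateField ℚ ℂ}
    (hf : HasFourierCoeffsIn f K) (h : K ≤ K') : HasFourierCoeffsIn f K' := by
  obtain ⟨n, a, ha, haK⟩ := hf
  exact ⟨n, a, ha, fun m => h (haK m)⟩

/-- The compositum over finitely many coset representatives serves every `γ`, hence also the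
infinitely many `γ` that send `∞` to a given cusp. -/
theorem IsModularFunction.exists_uniform_numberField {Γ : Subgroup SL(2, ℤ)}
    {f : ℍ → ℂ} (hΓ : Γ.FiniteIndex) (hf : IsModularFunction Γ f) {K : IntermediateField ℚ ℂ}
    (hK : NumberField K) (hfK : HasFourierCoeffsIn f K) :
    ∃ K' : IntermediateField ℚ ℂ, NumberField K' ∧ K ≤ K' ∧
      ∀ γ : SL(2, ℤ), HasFourierCoeffsIn (slashZero f γ) K' := by
  choose L hL hKL hfL using hf.exists_numberField_hasFourierCoeffsIn hΓ hK hfK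
  obtain ⟨R, hR⟩ := hΓ.exists_finset_mul
  have hfin : ∀ γ, FiniteDimensional ℚ (L γ) := fun γ => (hL γ).to_finiteDimensional
  have hsup : FiniteDimensional ℚ (⨆ r : R, L r : IntermediateField ℚ ℂ) :=
    IntermediateField.finiteDimensional_iSup_of_finite
  refine ⟨⨆ r : R, L r, { to_charZero := inferInstance, to_finiteDimensional := hsup }, ?_,
    fun γ => ?_⟩
  · obtain ⟨r, hr, -⟩ := hR 1
    exact (hKL r).trans (le_iSup (fun r : R => L r) ⟨r, hr⟩)
  · obtain ⟨r, hr, δ, hδ, rfl⟩ := hR γ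
    exact ((hfL r).mono (le_iSup (fun r : R => L r) ⟨r, hr⟩)).congr
      (hf.slashZero_mul_eventuallyEq hδ r).symm

theorem mainTheorem7 (Γ : Subgroup SL(2, ℤ)) (hΓ : Γ.FiniteIndex)
    (f : UpperHalfPlane → ℂ) (hf : IsModularFunction Γ f)
    (K : IntermediateField ℚ ℂ) (hK : NumberField K) (hfK : HasFourierCoeffsIn f K) :
    (∀ γ : SL(2, ℤ), ∃ K' : IntermediateField ℚ ℂ, NumberField K' ∧ K ≤ K' ∧
      HasFourierCoeffsIn (slashZero f γ) K') ∧
    (∀ c : OnePoint ℝ, IsCusp c (Γ.map (Matrix.SpecialLinearGroup.mapGL ℝ)) →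
      ∃ K' : IntermediateField ℚ ℂ, NumberField K' ∧ K ≤ K' ∧ HasCoeffsInAtCusp f c K') := by
  obtain ⟨K', hK', hle, h⟩ := hf.exists_uniform_numberField hΓ hK hfK
  exact ⟨fun γ => ⟨K', hK', hle, h γ⟩, fun c _ => ⟨K', hK', hle, fun γ _ => h γ⟩⟩
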